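/- **Setting.** Let $M$ be a connected complex manifold of dimension $2$ and $T'M$ its holomorphic tangent bundle, with local coordinates $(z^k,\eta^k)_{k=1,2}$ induced by the holomorphic charts of $M$. Let $D\subset T'M\setminus\{0\}$ be open, invariant under multiplication by nonzero complex numbers and meeting every fibre (for instance $D=T'M\setminus\{0\}$), and let $F:D\to(0,\infty)$ be a complex Finsler metric: $L:=F^2$ is smooth, $F(z,c\eta)=|c|F(z,\eta)$ for $c\in\mathbb C\setminus\{0\}$, and the matrix $g_{i\bar j}=\partial^2L/\partial\eta^i\partial\bar\eta^j$ is positive definite. Write $\dot\partial_k=\partial/\partial\eta^k$, let $(g^{\bar j i})$ be the inverse matrix, sum over repeated indices, and put $$N^k_j=g^{\bar mk}\frac{\partial g_{l\bar m}}{\partial z^j}\eta^l,\quad \delta_k=\frac{\partial}{\partial z^k}-N_k^j\dot\partial_j,\quad L^i_{jk}=g^{\bar li}\delta_kg_{j\bar l},\quad C^i_{jk}=g^{\bar li}\dot\partial_kg_{j\bar l},\quad T^i_{jk}=L^i_{jk}-L^i_{kj},$$ $$R^i_{j\bar hk}=-\delta_{\bar h}L^i_{jk}-\delta_{\bar h}(N^l_k)C^i_{jl},\qquad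 R_{\bar rj\bar hk}=g_{i\bar r}R^i_{j\bar hk},\qquad \delta_{\bar k}=\overline{\delta_k}.$$ For a function $f$ write $f_{|k}=\delta_kf$, $f_{|\bar k}=\delta_{\bar k}f$; an index $0$ or $\bar 0$ denotes contraction with $\eta$ or $\bar\eta$. In each chart let $$l^i=\frac{\eta^i}F,\quad l_i=g_{i\bar j}\bar l^{j},\quad (m^1,m^2)=\frac1{\sqrt{\det (g_{i\bar j})}}(-l_2,l_1),\quad m_i=g_{i\bar j}\bar m^{j},$$ $$A=m^jm^kl_hC^h_{kj},\quad J=l^jl^kl_iL^i_{jk},\quad V=l^jm^kl_iL^i_{jk},\quad Y=m^jl^km_iL^i_{jk},\quad H=m^jm^km_iL^i_{jk},$$ $$\Phi=A_{|\bar 0}+AF(\bar J+\bar Y),\qquad \Omega=A_{|\bar k}\bar m^{k}+A(\bar V+\bar H),$$ $$K^h_\lambda=2R_{\bar rj\bar hk}\bar l^{r}l^j\bar l^{h}l^k,\qquad K^h_\mu=2R_{\bar rj\bar hk}\bar m^{r}m^j\bar m^{h}m^k .$$ (The functions $A,J,V,Y,H,\Phi,\Omega$ depend on the chart.) **Theorem.**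 Assume that in every holomorphic chart: 1. (weakly Kähler) $g_{i\bar l}T^i_{jk}\eta^j\bar\eta^l=0$ on $D$ for $k=1,2$; 2. (weak symmetry) $R_{\bar0k\bar00}=R_{\bar00\bar0k}$ on $D$ for $k=1,2$; 3. $A\neq0$ on a dense subset of $D$ (for instance, everywhere on $D$); 4. $\Phi_{|k}=\Phi\,[(J+Y)l_k+(V+H)m_k]$ on $D$ for $k=1,2$. Then $K^h_\lambda=0$ and $K^h_\mu=-2L|\Omega|^2\le0$ on $D$, in every holomorphic chart. Moreover, $K^h_\mu$ is constant on $D$ if and only if there is a constant $c\in\mathbb C$ with $\Omega=c/F$ on $D$ in every holomorphic chart. -/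

import Mathlib

open scoped ContDiff Manifold ComplexOrder

noncomputable section

/-- The model space of complex surfaces. -/
abbrev C2 : Type := Fin 2 → ℂ

/-! ### Wirtinger derivatives

A point of a chart of the holomorphic tangent bundle is a pair `p = (z, η)`. -/

/-- The complex derivative `½ (∂_v f - i ∂_{iv} f)` along `v`. -/
def wirt (v : C2 × C2) (f : C2 × C2 → ℂ) (p : C2 × C2) : ℂ :=
  (1 / 2 : ℂ) * (fderiv ℝ f p v - Complex.I * fderiv ℝ f p (Complex.I • v))

/-- The conjugate derivative `½ (∂_v f + i ∂_{iv} f)` along `v`. -/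
def wirtBar (v : C2 × C2) (f : C2 × C2 → ℂ) (p : C2 × C2) : ℂ :=
  (1 / 2 : ℂ) * (fderiv ℝ f p v + Complex.I * fderiv ℝ f p (Complex.I • v))

/-- `∂/∂z^k` -/
def dZ (k : Fin 2) : (C2 × C2 → ℂ) → C2 × C2 → ℂ := wirt (Pi.single k 1, 0)

/-- `∂/∂z̄^k` -/
def dZbar (k : Fin 2) : (C2 × C2 → ℂ) → C2 × C2 → ℂ := wirtBar (Pi.single k 1, 0)

/-- `∂/∂η^k` -/
def dEta (k : Fin 2) : (C2 × C2 → ℂ) → C2 × C2 → ℂ := wirt (0, Pi.single k 1)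

/-- `∂/∂η̄^k` -/
def dEtaBar (k : Fin 2) : (C2 × C2 → ℂ) → C2 × C2 → ℂ := wirtBar (0, Pi.single k 1)

/-! ### Chern-Finsler geometry in a chart

All objects below are built from the expression `F = F(z, η)` of the metric function in a chart. -/

namespace LocalFinsler

/-- `L = F²`, as a complex valued function -/
def sq (F : C2 × C2 → ℝ) (p : C2 × C2) : ℂ := ((F p ^ 2 : ℝ) : ℂ)

/-- the fundamental tensor `g_{i j̄} = ∂²L / ∂η^i ∂η̄^j` -/
def g (F : C2 × C2 → ℝ) (i j : Fin 2) (p : C2 × C2) : ℂ := dEta i (dEtaBar j (sq F)) p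

/-- the matrix `(g_{i j̄})` -/
def gMat (F : C2 × C2 → ℝ) (p : C2 × C2) : Matrix (Fin 2) (Fin 2) ℂ :=
  Matrix.of fun i j => g F i j p

/-- `g^{j̄ i}`, so that `∑ j, g_{k j̄} g^{j̄ i} = δ_k^i` -/
def gInv (F : C2 × C2 → ℝ) (j i : Fin 2) (p : C2 × C2) : ℂ := (gMat F p)⁻¹ j i

/-- the nonlinear connection `N_j^k = g^{m̄ k} (∂g_{l m̄} / ∂z^j) η^l`; here `nlc F k j` is `N_j^k` -/
def nlc (F : C2 × C2 → ℝ) (k j : Fin 2) (p : C2 × C2) : ℂ :=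
  ∑ m, ∑ l, gInv F m k p * dZ j (g F l m) p * p.2 l

/-- `δ_k = ∂/∂z^k - N_k^j ∂/∂η^j`; this is also the horizontal covariant derivative `f ↦ f_{|k}`
of functions -/
def delta (F : C2 × C2 → ℝ) (k : Fin 2) (f : C2 × C2 → ℂ) (p : C2 × C2) : ℂ :=
  dZ k f p - ∑ j, nlc F j k p * dEta j f p

/-- `δ_k̄`, the conjugate of `δ_k`; this is also `f ↦ f_{|k̄}` on functions -/
def deltaBar (F : C2 × C2 → ℝ) (k : Fin 2) (f : C2 × C2 → ℂ) (p : C2 × C2) : ℂ :=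
  dZbar k f p - ∑ j, star (nlc F j k p) * dEtaBar j f p

/-- the horizontal coefficients `L^i_{jk} = g^{l̄ i} δ_k g_{j l̄}` -/
def connL (F : C2 × C2 → ℝ) (i j k : Fin 2) (p : C2 × C2) : ℂ :=
  ∑ l, gInv F l i p * delta F k (g F j l) p

/-- the vertical coefficients `C^i_{jk} = g^{l̄ i} ∂g_{j l̄} / ∂η^k` -/
def connC (F : C2 × C2 → ℝ) (i j k : Fin 2) (p : C2 × C2) : ℂ :=
  ∑ l, gInv F l i p * dEta k (g F j l) p

/-- the torsion `T^i_{jk} = L^i_{jk} - L^i_{kj}` -/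
def torsion (F : C2 × C2 → ℝ) (i j k : Fin 2) (p : C2 × C2) : ℂ :=
  connL F i j k p - connL F i k j p

/-- the horizontal curvature `R^i_{j h̄ k} = - δ_h̄ L^i_{jk} - δ_h̄ (N_k^l) C^i_{jl}` -/
def curv (F : C2 × C2 → ℝ) (i j h k : Fin 2) (p : C2 × C2) : ℂ :=
  - deltaBar F h (connL F i j k) p - ∑ l, deltaBar F h (nlc F l k) p * connC F i j l p

/-- `R_{r̄ j h̄ k} = g_{i r̄} R^i_{j h̄ k}` -/
def curvLow (F : C2 × C2 → ℝ) (r j h k : Fin 2) (p : C2 × C2) : ℂ :=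
  ∑ i, g F i r p * curv F i j h k p

/-- The Riemann form `𝐑(W, Z̄, X, Ȳ) = 𝒢(R(X, Ȳ) W, Z̄)` on the horizontal vectors with components
`W, Z, X, Y` in the frame `δ_1, δ_2`. -/
def riemann (F : C2 × C2 → ℝ) (p : C2 × C2) (W Z X Y : C2) : ℂ :=
  ∑ r, ∑ j, ∑ h, ∑ k, curvLow F r j h k p * star (Z r) * W j * star (Y h) * X k

/-! ### The local complex Berwald frame -/

/-- `l^i = η^i / F` -/
def lUp (F : C2 × C2 → ℝ) (i : Fin 2) (p : C2 × C2) : ℂ := p.2 i / (F p : ℂ)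

/-- `l_i = g_{i j̄} l^j̄` -/
def lDown (F : C2 × C2 → ℝ) (i : Fin 2) (p : C2 × C2) : ℂ := ∑ j, g F i j p * star (lUp F j p)

/-- `√g`, where `g = det (g_{i j̄})` -/
def sqrtDet (F : C2 × C2 → ℝ) (p : C2 × C2) : ℂ := (Real.sqrt ((gMat F p).det.re) : ℂ)

/-- `m^1 = - l_2 / √g`, `m^2 = l_1 / √g` -/
def mUp (F : C2 × C2 → ℝ) (i : Fin 2) (p : C2 × C2) : ℂ :=
  ![- lDown F 1 p / sqrtDet F p, lDown F 0 p / sqrtDet F p] i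

/-- `m_i = g_{i j̄} m^j̄` -/
def mDown (F : C2 × C2 → ℝ) (i : Fin 2) (p : C2 × C2) : ℂ := ∑ j, g F i j p * star (mUp F j p)

/-- `A = m^j m^k l_h C^h_{kj}` -/
def coefA (F : C2 × C2 → ℝ) (p : C2 × C2) : ℂ :=
  ∑ h, ∑ j, ∑ k, mUp F j p * mUp F k p * lDown F h p * connC F h k j p

/-- `J = l^j l^k l_i L^i_{jk}` -/
def coefJ (F : C2 × C2 → ℝ) (p : C2 × C2) : ℂ :=
  ∑ i, ∑ j, ∑ k, lUp F j p * lUp F k p * lDown F i p * connL F i j k p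

/-- `V = l^j m^k l_i L^i_{jk}` -/
def coefV (F : C2 × C2 → ℝ) (p : C2 × C2) : ℂ :=
  ∑ i, ∑ j, ∑ k, lUp F j p * mUp F k p * lDown F i p * connL F i j k p

/-- `Y = m^j l^k m_i L^i_{jk}` -/
def coefY (F : C2 × C2 → ℝ) (p : C2 × C2) : ℂ :=
  ∑ i, ∑ j, ∑ k, mUp F j p * lUp F k p * mDown F i p * connL F i j k p

/-- `H = m^j m^k m_i L^i_{jk}` -/
def coefH (F : C2 × C2 → ℝ) (p : C2 × C2) : ℂ :=
  ∑ i, ∑ j, ∑ k, mUp F j p * mUp F k p * mDown F i p * connL F i j k p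

/-- `Φ = A_{|0̄} + A F (J̄ + Ȳ)`, where `A_{|0̄} = η̄^k A_{|k̄}` -/
def Phi (F : C2 × C2 → ℝ) (p : C2 × C2) : ℂ :=
  (∑ k, star (p.2 k) * deltaBar F k (coefA F) p)
    + coefA F p * (F p : ℂ) * (star (coefJ F p) + star (coefY F p))

/-- `Ω = A_{|k̄} m^k̄ + A (V̄ + H̄)` -/
def Omega (F : C2 × C2 → ℝ) (p : C2 × C2) : ℂ :=
  (∑ k, deltaBar F k (coefA F) p * star (mUp F k p))
    + coefA F p * (star (coefV F p) + star (coefH F p))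

/-- The horizontal holomorphic sectional curvature `2 𝐑(λ, λ̄, λ, λ̄)` in direction
`λ = l^i δ_i`. -/
def secLambda (F : C2 × C2 → ℝ) (p : C2 × C2) : ℂ :=
  2 * riemann F p (fun i => lUp F i p) (fun i => lUp F i p) (fun i => lUp F i p)
    (fun i => lUp F i p)

/-- The horizontal holomorphic sectional curvature `2 𝐑(μ, μ̄, μ, μ̄)` in direction
`μ = m^i δ_i`. -/
def secMu (F : C2 × C2 → ℝ) (p : C2 × C2) : ℂ :=
  2 * riemann F p (fun i => mUp F i p) (fun i => mUp F i p) (fun i => mUp F i p)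
    (fun i => mUp F i p)

end LocalFinsler

/-! ### Complex Finsler surfaces -/

section Manifold

variable (M : Type*) [TopologicalSpace M] [ChartedSpace C2 M] [IsManifold 𝓘(ℂ, C2) ω M]

/-- The holomorphic charts of the complex surface `M`. -/
def holCharts : Set (OpenPartialHomeomorph M C2) := IsManifold.maximalAtlas 𝓘(ℂ, C2) ω M

variable {M}

/-- The tangent vector of `M` with coordinates `(z, η)` in the chart `e`. -/
def tangentOfCoords (e : OpenPartialHomeomorph M C2) (p : C2 × C2) : TangentBundle 𝓘(ℂ, C2) M :=
  ⟨e.symm p.1, mfderiv 𝓘(ℂ, C2) 𝓘(ℂ, C2) e.symm p.1 p.2⟩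

/-- The coordinates, in the chart `e`, of the tangent vectors in `D`. -/
def coordDomain (D : Set (TangentBundle 𝓘(ℂ, C2) M)) (e : OpenPartialHomeomorph M C2) :
    Set (C2 × C2) :=
  {p | p.1 ∈ e.target ∧ tangentOfCoords e p ∈ D}

variable (M)

/-- A two dimensional complex Finsler space. The metric function `F` lives on an open set `dom` of
nonzero tangent vectors that meets every fibre and is stable under multiplication by nonzero
complex numbers; the case of all nonzero vectors is the metric defined on the whole slit tangent
bundle. Values of `F` outside `dom` play no role. -/
structure ComplexFinslerSurface where
  /-- the domain of the metric -/
  dom : Set (TangentBundle 𝓘(ℂ, C2) M)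
  /-- the metric function -/
  F : TangentBundle 𝓘(ℂ, C2) M → ℝ
  isOpen_dom : IsOpen dom
  ne_zero : ∀ u ∈ dom, u.2 ≠ 0
  exists_mem : ∀ x : M, ∃ v : TangentSpace 𝓘(ℂ, C2) x,
    (⟨x, v⟩ : TangentBundle 𝓘(ℂ, C2) M) ∈ dom
  smul_mem : ∀ (x : M) (v : TangentSpace 𝓘(ℂ, C2) x) (c : ℂ), c ≠ 0 →
    (⟨x, v⟩ : TangentBundle 𝓘(ℂ, C2) M) ∈ dom → (⟨x, c • v⟩ : TangentBundle 𝓘(ℂ, C2) M) ∈ dom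
  pos : ∀ u ∈ dom, 0 < F u
  homogeneous : ∀ (x : M) (v : TangentSpace 𝓘(ℂ, C2) x) (c : ℂ), c ≠ 0 →
    (⟨x, v⟩ : TangentBundle 𝓘(ℂ, C2) M) ∈ dom → F ⟨x, c • v⟩ = ‖c‖ * F ⟨x, v⟩
  smooth : ∀ e ∈ holCharts M,
    ContDiffOn ℝ ∞ (fun p => F (tangentOfCoords e p) ^ 2) (coordDomain dom e)
  posDef : ∀ e ∈ holCharts M, ∀ p ∈ coordDomain dom e,
    (LocalFinsler.gMat (fun q => F (tangentOfCoords e q)) p).PosDef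

variable {M}

namespace ComplexFinslerSurface

variable (S : ComplexFinslerSurface M)

/-- The expression `F(z, η)` of the metric function in the chart `e`. -/
def loc (e : OpenPartialHomeomorph M C2) (p : C2 × C2) : ℝ := S.F (tangentOfCoords e p)

/-- The coordinates `(z, η)`, in the chart `e`, of the vectors on which the metric is defined. -/
def locDom (e : OpenPartialHomeomorph M C2) : Set (C2 × C2) := coordDomain S.dom e

/-- weakly Kähler: `g_{i l̄} T^i_{jk} η^j η̄^l = 0` -/
def IsWeaklyKahler : Prop :=
  ∀ e ∈ holCharts M, ∀ p ∈ S.locDom e, ∀ k : Fin 2,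
    ∑ i, ∑ l, ∑ j, LocalFinsler.g (S.loc e) i l p * LocalFinsler.torsion (S.loc e) i j k p
      * p.2 j * star (p.2 l) = 0

/-- the weak symmetry condition `R_{0̄ k 0̄ 0} = R_{0̄ 0 0̄ k}` on the curvature, where an index `0`
denotes contraction with `η` -/
def IsWeaklySymmetric : Prop :=
  ∀ e ∈ holCharts M, ∀ p ∈ S.locDom e, ∀ k : Fin 2,
    ∑ r, ∑ h, ∑ s, LocalFinsler.curvLow (S.loc e) r k h s p
        * star (p.2 r) * star (p.2 h) * p.2 s
      = ∑ r, ∑ j, ∑ h, LocalFinsler.curvLow (S.loc e) r j h k p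
        * star (p.2 r) * p.2 j * star (p.2 h)

/-- `A ≠ 0` on a dense part of the domain of the metric; this holds in particular if `A` vanishes
nowhere. -/
def ANonvanishing : Prop :=
  ∀ e ∈ holCharts M,
    S.locDom e ⊆ closure {p | p ∈ S.locDom e ∧ LocalFinsler.coefA (S.loc e) p ≠ 0}

/-- `Φ_{|k} = Φ [(J + Y) l_k + (V + H) m_k]` -/
def PhiCondition : Prop :=
  ∀ e ∈ holCharts M, ∀ p ∈ S.locDom e, ∀ k : Fin 2,
    LocalFinsler.delta (S.loc e) k (LocalFinsler.Phi (S.loc e)) p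
      = LocalFinsler.Phi (S.loc e) p *
        ((LocalFinsler.coefJ (S.loc e) p + LocalFinsler.coefY (S.loc e) p)
            * LocalFinsler.lDown (S.loc e) k p
          + (LocalFinsler.coefV (S.loc e) p + LocalFinsler.coefH (S.loc e) p)
            * LocalFinsler.mDown (S.loc e) k p)

end ComplexFinslerSurface

end Manifold

end

/-! The argument is tensor calculus in one chart, so it is carried out in an abstract ring with
derivations (`FinslerRing`) and then transported to smooth functions.

Two facts drive it. The connection is built so that `δ_k` kills `∂L/∂η̄^m` (`delta_Db`). In fibre
dimension two a symmetric tensor killed by `η` is a multiple of `m_i m_j`; hence the Hessian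
`∂²L/∂η^i∂η^j` equals `F A m_i m_j` (`B_eq`). Its `δ_h̄`-derivative is `F m_i m_j X_h`, where `X_h`
is `A_{|h̄}` corrected by `A` times the conjugate trace of the connection. The contractions of `X`
with `η̄` and `m̄` are `Φ` and `Ω`, and `X` also gives the mixed derivative of the nonlinear
connection (`de_Nb`). This leads to `deb_R0`: the curvature is the `η̄`-derivative of its
contraction `R0`, minus `L m̄_r m_j X̄_k X_h`. It therefore suffices to prove `R0 = 0`.

The weak Kähler and weak symmetry conditions, with `A` regular, make the contracted curvature `Q_j`
proportional to `l_j` (`mU_Q`). Then `Q_j = κ L ∂L/∂η^j`, where `κ` does not depend on the fibre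
variable (`de_kappa`). The condition on `Φ` determines the contraction of the curvature with `η` in
its last index (`Rm_eta`). Comparing it with the fibre derivative of the weak symmetry gives `κ |A|²
= 0`, so `κ = 0` (`kappa_eq_zero`), and then `R0 = 0` (`R0_eq_zero`). What remains is `R_{r̄jh̄k} =
-L m̄_r m_j X̄_k X_h`, and both sectional curvatures follow from `m_j η^j = 0` and `m_j m^j = 1`.

For the last claim, `R0 = 0` makes `δ_j` and `δ_h̄` commute. If `L|Ω|²` is a nonzero constant, both
horizontal derivatives of `Ω̄` are determined, and their commutation forces `Ω̄ X̄_j X_h = 0`, hence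
`Ω = 0`, a contradiction (`Om_eq_zero`). So constancy of `K_μ` implies `Ω = 0`; conversely, `Ω =
c/F` gives `L|Ω|² = |c|²`. -/

/-- A commutative ring with involution and the Wirtinger derivations of a chart of the tangent
bundle of a complex surface, together with the ring elements given by the fibre coordinates `eta`,
a metric function `F` with `L = F²`, and the square root `s` of the determinant of the fundamental
tensor. -/
structure FinslerRing (R : Type*) [CommRing R] [StarRing R] where
  dz : Fin 2 → Derivation ℤ R R
  dzb : Fin 2 → Derivation ℤ R R
  de : Fin 2 → Derivation ℤ R R
  deb : Fin 2 → Derivation ℤ R R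
  star_dz : ∀ k f, star (dz k f) = dzb k (star f)
  star_de : ∀ k f, star (de k f) = deb k (star f)
  de_de : ∀ i j f, de i (de j f) = de j (de i f)
  de_deb : ∀ i j f, de i (deb j f) = deb j (de i f)
  dz_de : ∀ i j f, dz i (de j f) = de j (dz i f)
  dz_deb : ∀ i j f, dz i (deb j f) = deb j (dz i f)
  dz_dzb : ∀ i j f, dz i (dzb j f) = dzb j (dz i f)
  eta : Fin 2 → R
  de_eta : ∀ i j, de i (eta j) = if i = j then 1 else 0
  deb_eta : ∀ i j, deb i (eta j) = 0
  dz_eta : ∀ i j, dz i (eta j) = 0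
  dzb_eta : ∀ i j, dzb i (eta j) = 0
  L : R
  star_L : star L = L
  euler : eta 0 * de 0 L + eta 1 * de 1 L = L
  F : R
  Finv : R
  star_F : star F = F
  F_mul_F : F * F = L
  F_mul_Finv : F * Finv = 1
  s : R
  sinv : R
  star_s : star s = s
  s_mul_s : s * s = de 0 (deb 0 L) * de 1 (deb 1 L) - de 0 (deb 1 L) * de 1 (deb 0 L)
  s_mul_sinv : s * sinv = 1
  two_cancel : ∀ x : R, 2 * x = 0 → x = 0

/-! ### Chern–Finsler tensors in the abstract ring. -/

namespace FinslerRing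

variable {R : Type*} [CommRing R] [StarRing R] (S : FinslerRing R)

/-- the fundamental tensor -/
def g (i j : Fin 2) : R := S.de i (S.deb j S.L)
/-- `∂L / ∂η^i` -/
def D (i : Fin 2) : R := S.de i S.L
/-- `∂L / ∂η̄^i` -/
def Db (i : Fin 2) : R := S.deb i S.L
/-- `∂²L / ∂η^i ∂η^j` -/
def B (i j : Fin 2) : R := S.de i (S.de j S.L)
/-- `∂²L / ∂η̄^i ∂η̄^j` -/
def Bb (i j : Fin 2) : R := S.deb i (S.deb j S.L)
/-- `η̄^i` -/
def eb (i : Fin 2) : R := star (S.eta i)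
/-- the inverse of the fundamental tensor -/
def gi (m k : Fin 2) : R :=
  S.sinv * S.sinv * (![![S.g 1 1, - S.g 0 1], ![- S.g 1 0, S.g 0 0]] m k)
/-- the nonlinear connection -/
def N (k j : Fin 2) : R := ∑ m, ∑ l, S.gi m k * S.dz j (S.g l m) * S.eta l
/-- the conjugate of the nonlinear connection -/
def Nb (k j : Fin 2) : R := star (S.N k j)
/-- the adapted horizontal derivation `δ_k` -/
def delta (k : Fin 2) : Derivation ℤ R R := S.dz k - (S.N 0 k • S.de 0 + S.N 1 k • S.de 1)
/-- the conjugate of `δ_k` -/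
def deltab (k : Fin 2) : Derivation ℤ R R := S.dzb k - (S.Nb 0 k • S.deb 0 + S.Nb 1 k • S.deb 1)
/-- the horizontal connection coefficients -/
def G (i j k : Fin 2) : R := ∑ l, S.gi l i * S.delta k (S.g j l)
/-- conjugates of the horizontal connection coefficients -/
def Gb (i j k : Fin 2) : R := star (S.G i j k)
/-- the vertical connection coefficients -/
def C (i j k : Fin 2) : R := ∑ l, S.gi l i * S.de k (S.g j l)
/-- the horizontal curvature -/
def curv (i j h k : Fin 2) : R :=
  - S.deltab h (S.G i j k) - ∑ l, S.deltab h (S.N l k) * S.C i j l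
/-- the lowered horizontal curvature -/
def Rm (r j h k : Fin 2) : R := ∑ i, S.g i r * S.curv i j h k
/-- `l_i` -/
def lD (i : Fin 2) : R := ∑ j, S.g i j * star (S.eta j * S.Finv)
/-- `m^i` -/
def mU (i : Fin 2) : R := ![- S.lD 1 * S.sinv, S.lD 0 * S.sinv] i
/-- `m_i` -/
def mD (i : Fin 2) : R := ∑ j, S.g i j * star (S.mU j)
/-- the conjugate of `m^i` -/
def mUb (i : Fin 2) : R := star (S.mU i)
/-- the conjugate of `m_i` -/
def mDb (i : Fin 2) : R := star (S.mD i)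
/-- the coefficient `A` -/
def A : R := ∑ h, ∑ j, ∑ k, S.mU j * S.mU k * S.lD h * S.C h k j
/-- the conjugate of `A` -/
def Ab : R := star S.A
/-- the trace `L^i_{ik}` -/
def tr (k : Fin 2) : R := S.G 0 0 k + S.G 1 1 k
/-- the conjugate trace -/
def trb (k : Fin 2) : R := star (S.tr k)
/-- `X_h̄ = A_{|h̄} + A (conj L^i_{ih})` -/
def X (h : Fin 2) : R := S.deltab h S.A + S.A * S.trb h
/-- the conjugate of `X` -/
def Xb (h : Fin 2) : R := star (S.X h)
/-- the contraction of `X` with `η̄` -/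
def Ph : R := S.eb 0 * S.X 0 + S.eb 1 * S.X 1
/-- the conjugate of `Ph` -/
def Phb : R := star S.Ph
/-- the contraction of `X` with `m̄` -/
def Om : R := S.X 0 * S.mUb 0 + S.X 1 * S.mUb 1
/-- the conjugate of `Om` -/
def Omb : R := star S.Om

/-! ### Conjugation -/

lemma star_dzb (k : Fin 2) (f : R) : star (S.dzb k f) = S.dz k (star f) := by
  rw [← star_star f, ← S.star_dz, star_star, star_star]
lemma star_deb (k : Fin 2) (f : R) : star (S.deb k f) = S.de k (star f) := by
  rw [← star_star f, ← S.star_de, star_star, star_star]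
lemma star_eta (i : Fin 2) : star (S.eta i) = S.eb i := rfl
lemma star_eb (i : Fin 2) : star (S.eb i) = S.eta i := star_star _
lemma star_D (i : Fin 2) : star (S.D i) = S.Db i := by rw [D, star_de, star_L, Db]
lemma star_Db (i : Fin 2) : star (S.Db i) = S.D i := by rw [Db, star_deb, star_L, D]
lemma star_g (i j : Fin 2) : star (S.g i j) = S.g j i := by
  rw [g, star_de, star_deb, star_L, ← de_deb, g]
lemma star_B (i j : Fin 2) : star (S.B i j) = S.Bb i j := by
  rw [B, star_de, star_de, star_L, Bb]
lemma star_N (i j : Fin 2) : star (S.N i j) = S.Nb i j := rfl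
lemma star_Nb (i j : Fin 2) : star (S.Nb i j) = S.N i j := star_star _
lemma star_G (i j k : Fin 2) : star (S.G i j k) = S.Gb i j k := rfl
lemma star_Gb (i j k : Fin 2) : star (S.Gb i j k) = S.G i j k := star_star _
lemma star_mU (i : Fin 2) : star (S.mU i) = S.mUb i := rfl
lemma star_mUb (i : Fin 2) : star (S.mUb i) = S.mU i := star_star _
lemma star_mD (i : Fin 2) : star (S.mD i) = S.mDb i := rfl
lemma star_mDb (i : Fin 2) : star (S.mDb i) = S.mD i := star_star _
lemma star_A : star S.A = S.Ab := rfl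
lemma star_Ab : star S.Ab = S.A := star_star _
lemma star_tr (i : Fin 2) : star (S.tr i) = S.trb i := rfl
lemma star_trb (i : Fin 2) : star (S.trb i) = S.tr i := star_star _
lemma star_X (i : Fin 2) : star (S.X i) = S.Xb i := rfl
lemma star_Xb (i : Fin 2) : star (S.Xb i) = S.X i := star_star _
lemma star_Ph : star S.Ph = S.Phb := rfl
lemma star_Phb : star S.Phb = S.Ph := star_star _
lemma star_Omb : star S.Omb = S.Om := star_star _

lemma delta_apply (k : Fin 2) (f : R) :
    S.delta k f = S.dz k f - (S.N 0 k * S.de 0 f + S.N 1 k * S.de 1 f) := rfl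
lemma deltab_apply (k : Fin 2) (f : R) :
    S.deltab k f = S.dzb k f - (S.Nb 0 k * S.deb 0 f + S.Nb 1 k * S.deb 1 f) := rfl
lemma star_delta (k : Fin 2) (f : R) : star (S.delta k f) = S.deltab k (star f) := by
  simp only [delta_apply, deltab_apply, star_sub, star_add, star_mul', star_dz, star_de, star_N]
lemma star_deltab (k : Fin 2) (f : R) : star (S.deltab k f) = S.delta k (star f) := by
  rw [← star_star f, ← S.star_delta, star_star, star_star]

lemma deb_deb (i j : Fin 2) (f : R) : S.deb i (S.deb j f) = S.deb j (S.deb i f) := by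
  have := congrArg star (S.de_de i j (star f))
  simpa only [star_de, star_star] using this
lemma dzb_deb (i j : Fin 2) (f : R) : S.dzb i (S.deb j f) = S.deb j (S.dzb i f) := by
  have := congrArg star (S.dz_de i j (star f))
  simpa only [star_de, star_dz, star_star] using this
lemma dzb_de (i j : Fin 2) (f : R) : S.dzb i (S.de j f) = S.de j (S.dzb i f) := by
  have := congrArg star (S.dz_deb i j (star f))
  simpa only [star_deb, star_dz, star_star] using this
lemma de_eb (i j : Fin 2) : S.de i (S.eb j) = 0 := by
  rw [eb, ← star_deb, deb_eta, star_zero]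
lemma dz_eb (i j : Fin 2) : S.dz i (S.eb j) = 0 := by
  rw [eb, ← star_dzb, dzb_eta, star_zero]
lemma delta_eb (i j : Fin 2) : S.delta i (S.eb j) = 0 := by
  rw [delta_apply, dz_eb, de_eb, de_eb]; ring
lemma deltab_eta (i j : Fin 2) : S.deltab i (S.eta j) = 0 := by
  rw [deltab_apply, dzb_eta, deb_eta, deb_eta]; ring
lemma delta_eta (i j : Fin 2) : S.delta i (S.eta j) = - S.N j i := by
  revert j
  refine Fin.forall_fin_two.2 ⟨?_, ?_⟩ <;>
  · simp [delta_apply, dz_eta, de_eta]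

/-! ### Homogeneity -/

lemma de_contract (a : Fin 2 → R) (i : Fin 2) :
    S.de i (S.eta 0 * a 0 + S.eta 1 * a 1)
      = a i + S.eta 0 * S.de i (a 0) + S.eta 1 * S.de i (a 1) := by
  revert i
  refine Fin.forall_fin_two.2 ⟨?_, ?_⟩ <;>
  · simp [Derivation.leibniz, de_eta]; ring
lemma deb_contract (a : Fin 2 → R) (i : Fin 2) :
    S.deb i (S.eta 0 * a 0 + S.eta 1 * a 1)
      = S.eta 0 * S.deb i (a 0) + S.eta 1 * S.deb i (a 1) := by
  simp [Derivation.leibniz, deb_eta]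
lemma dz_contract (a : Fin 2 → R) (i : Fin 2) :
    S.dz i (S.eta 0 * a 0 + S.eta 1 * a 1)
      = S.eta 0 * S.dz i (a 0) + S.eta 1 * S.dz i (a 1) := by
  simp [Derivation.leibniz, dz_eta]
lemma deltab_contract (a : Fin 2 → R) (i : Fin 2) :
    S.deltab i (S.eta 0 * a 0 + S.eta 1 * a 1)
      = S.eta 0 * S.deltab i (a 0) + S.eta 1 * S.deltab i (a 1) := by
  simp [Derivation.leibniz, deltab_eta]
lemma delta_contract (a : Fin 2 → R) (i : Fin 2) :
    S.delta i (S.eta 0 * a 0 + S.eta 1 * a 1)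
      = S.eta 0 * S.delta i (a 0) + S.eta 1 * S.delta i (a 1)
        - (S.N 0 i * a 0 + S.N 1 i * a 1) := by
  simp [Derivation.leibniz, delta_eta]; ring
lemma de_contract_eb (a : Fin 2 → R) (i : Fin 2) :
    S.de i (S.eb 0 * a 0 + S.eb 1 * a 1)
      = S.eb 0 * S.de i (a 0) + S.eb 1 * S.de i (a 1) := by
  simp [Derivation.leibniz, de_eb]
lemma delta_contract_eb (a : Fin 2 → R) (i : Fin 2) :
    S.delta i (S.eb 0 * a 0 + S.eb 1 * a 1)
      = S.eb 0 * S.delta i (a 0) + S.eb 1 * S.delta i (a 1) := by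
  simp [Derivation.leibniz, delta_eb]
lemma deb_contract_eb (a : Fin 2 → R) (i : Fin 2) :
    S.deb i (S.eb 0 * a 0 + S.eb 1 * a 1)
      = a i + S.eb 0 * S.deb i (a 0) + S.eb 1 * S.deb i (a 1) := by
  have := congrArg star (S.de_contract (fun j => star (a j)) i)
  simpa only [star_de, star_add, star_mul', star_star, star_eta] using this

lemma eta_D : S.eta 0 * S.D 0 + S.eta 1 * S.D 1 = S.L := S.euler
lemma eb_Db : S.eb 0 * S.Db 0 + S.eb 1 * S.Db 1 = S.L := by
  have := congrArg star S.eta_D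
  simpa only [star_add, star_mul', star_eta, star_D, star_L] using this
lemma eta_g (j : Fin 2) : S.eta 0 * S.g 0 j + S.eta 1 * S.g 1 j = S.Db j := by
  have h := congrArg (S.deb j) S.eta_D
  rw [deb_contract] at h
  simpa only [g, D, Db, de_deb] using h
lemma eb_g (j : Fin 2) : S.eb 0 * S.g j 0 + S.eb 1 * S.g j 1 = S.D j := by
  have := congrArg star (S.eta_g j)
  simpa only [star_add, star_mul', star_eta, star_Db, star_g] using this
lemma B_symm (i j : Fin 2) : S.B i j = S.B j i := S.de_de i j _
lemma eta_B (j : Fin 2) : S.eta 0 * S.B 0 j + S.eta 1 * S.B 1 j = 0 := by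
  have h := congrArg (S.de j) S.eta_D
  rw [de_contract] at h
  have h0 := S.B_symm 0 j
  have h1 := S.B_symm 1 j
  simp only [B, D] at *
  linear_combination h + S.eta 0 * h0 + S.eta 1 * h1
lemma de_g_symm (i j k : Fin 2) : S.de i (S.g j k) = S.de j (S.g i k) := S.de_de i j _
lemma eta_de_g (k l : Fin 2) :
    S.eta 0 * S.de 0 (S.g k l) + S.eta 1 * S.de 1 (S.g k l) = 0 := by
  have h := congrArg (S.de k) (S.eta_g l)
  rw [S.de_contract (fun i => S.g i l)] at h
  rw [S.de_g_symm 0, S.de_g_symm 1]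
  have : S.de k (S.Db l) = S.g k l := rfl
  linear_combination h + this
lemma eb_de_g (l j : Fin 2) :
    S.eb 0 * S.de l (S.g j 0) + S.eb 1 * S.de l (S.g j 1) = S.B l j := by
  have h := congrArg (S.de l) (S.eb_g j)
  rw [de_contract_eb] at h
  simpa only [B, D] using h

/-! ### Raising and lowering indices -/

lemma det_g : S.g 0 0 * S.g 1 1 - S.g 0 1 * S.g 1 0 = S.s * S.s := S.s_mul_s.symm
lemma sinv_sq_mul_det :
    S.sinv * S.sinv * (S.g 0 0 * S.g 1 1 - S.g 0 1 * S.g 1 0) = 1 := by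
  rw [det_g]; linear_combination (S.s * S.sinv + 1) * S.s_mul_sinv
lemma lower_raise (v : Fin 2 → R) (m : Fin 2) :
    (S.gi 0 0 * v 0 + S.gi 1 0 * v 1) * S.g 0 m
      + (S.gi 0 1 * v 0 + S.gi 1 1 * v 1) * S.g 1 m = v m := by
  revert m
  have h := S.sinv_sq_mul_det
  refine Fin.forall_fin_two.2 ⟨?_, ?_⟩
  · simp [gi]; linear_combination v 0 * h
  · simp [gi]; linear_combination v 1 * h
-- Nondegeneracy of the metric: an identity with an upper index may be checked after lowering it,
-- which avoids the explicit inverse matrix.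
lemma g_cancel (u v : Fin 2 → R)
    (h : ∀ m, u 0 * S.g 0 m + u 1 * S.g 1 m = v 0 * S.g 0 m + v 1 * S.g 1 m) (i : Fin 2) :
    u i = v i := by
  revert i
  have hd := S.sinv_sq_mul_det
  have h0 := h 0
  have h1 := h 1
  refine Fin.forall_fin_two.2 ⟨?_, ?_⟩
  · linear_combination (S.sinv * S.sinv) * (S.g 1 1 * h0 - S.g 1 0 * h1) - (u 0 - v 0) * hd
  · linear_combination (S.sinv * S.sinv) * (S.g 0 0 * h1 - S.g 0 1 * h0) - (u 1 - v 1) * hd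
lemma g_cancel' (u v : Fin 2 → R)
    (h : ∀ m, u 0 * S.g m 0 + u 1 * S.g m 1 = v 0 * S.g m 0 + v 1 * S.g m 1) (i : Fin 2) :
    u i = v i := by
  have := S.g_cancel (fun i => star (u i)) (fun i => star (v i)) (fun m => by
    have := congrArg star (h m)
    simpa only [star_add, star_mul', star_g] using this) i
  exact star_injective this

lemma N_g (j m : Fin 2) :
    S.N 0 j * S.g 0 m + S.N 1 j * S.g 1 m = S.dz j (S.Db m) := by
  have key : ∀ k, S.N k j = S.gi 0 k * S.dz j (S.Db 0) + S.gi 1 k * S.dz j (S.Db 1) := by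
    intro k
    have h0 := S.dz_contract (fun l => S.g l 0) j
    have h1 := S.dz_contract (fun l => S.g l 1) j
    rw [eta_g] at h0 h1
    simp only [N, Fin.sum_univ_two]
    linear_combination - S.gi 0 k * h0 - S.gi 1 k * h1
  rw [key, key]
  exact S.lower_raise (fun i => S.dz j (S.Db i)) m
lemma G_g (j k m : Fin 2) :
    S.G 0 j k * S.g 0 m + S.G 1 j k * S.g 1 m = S.delta k (S.g j m) := by
  simp only [G, Fin.sum_univ_two]
  exact S.lower_raise (fun i => S.delta k (S.g j i)) m
lemma C_g (j k m : Fin 2) :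
    S.C 0 j k * S.g 0 m + S.C 1 j k * S.g 1 m = S.de k (S.g j m) := by
  simp only [C, Fin.sum_univ_two]
  exact S.lower_raise (fun i => S.de k (S.g j i)) m

/-- By homogeneity `g_{l m̄} η^l = ∂L/∂η̄^m`, so `N` is exactly the correction that cancels `∂/∂z^k`
on this covector. Consequently `L` is horizontally constant. -/
lemma delta_Db (k m : Fin 2) : S.delta k (S.Db m) = 0 := by
  have h := S.N_g k m
  rw [delta_apply]
  simp only [g, Db] at *
  linear_combination - h
lemma deltab_D (k m : Fin 2) : S.deltab k (S.D m) = 0 := by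
  rw [← star_Db, ← star_delta, delta_Db, star_zero]
lemma delta_L (k : Fin 2) : S.delta k S.L = 0 := by
  have h := S.delta_contract_eb S.Db k
  rw [eb_Db, delta_Db, delta_Db] at h
  linear_combination h
lemma deltab_L (k : Fin 2) : S.deltab k S.L = 0 := by
  rw [← star_L, ← star_delta, delta_L, star_zero]
lemma N_D (k : Fin 2) : S.N 0 k * S.D 0 + S.N 1 k * S.D 1 = S.dz k S.L := by
  have h := S.delta_L k
  rw [delta_apply] at h
  simp only [D]
  linear_combination -h
-- Differentiate `N_g` along the fibre and use the symmetry of `∂g_{j m̄}/∂η^i` in `i` and `j`. This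
-- puts `L^i_{jk}` into the commutator of `δ` with the fibre derivatives.
lemma de_N (i j k : Fin 2) : S.de j (S.N i k) = S.G i j k := by
  refine S.g_cancel (fun i => S.de j (S.N i k)) (fun i => S.G i j k) (fun m => ?_) i
  have h := congrArg (S.de j) (S.N_g k m)
  simp only [Derivation.leibniz, map_add, smul_eq_mul, ← S.dz_de] at h
  have h2 := S.G_g j k m
  rw [delta_apply] at h2
  have h3 : S.de j (S.Db m) = S.g j m := rfl
  rw [h3, S.de_g_symm j, S.de_g_symm j] at h
  linear_combination h - h2
lemma deb_N_g (n k j : Fin 2) :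
    S.deb n (S.N 0 k) * S.g 0 j + S.deb n (S.N 1 k) * S.g 1 j = S.delta k (S.Bb n j) := by
  have h := congrArg (S.deb n) (S.N_g k j)
  simp only [Derivation.leibniz, map_add, smul_eq_mul, ← S.dz_deb] at h
  rw [delta_apply]
  simp only [Bb, g, Db, S.de_deb] at *
  linear_combination h
lemma G_eta (i k : Fin 2) : S.eta 0 * S.G i 0 k + S.eta 1 * S.G i 1 k = S.N i k := by
  refine S.g_cancel (fun i => S.eta 0 * S.G i 0 k + S.eta 1 * S.G i 1 k)
    (fun i => S.N i k) (fun m => ?_) i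
  have h := S.delta_contract (fun i => S.g i m) k
  rw [eta_g, delta_Db, ← G_g, ← G_g] at h
  linear_combination -h
lemma D_G (k j : Fin 2) : S.D 0 * S.G 0 k j + S.D 1 * S.G 1 k j = S.delta j (S.D k) := by
  have h := S.delta_contract_eb (S.g k) j
  rw [eb_g, ← G_g, ← G_g] at h
  linear_combination -h - S.G 0 k j * S.eb_g 0 - S.G 1 k j * S.eb_g 1
lemma D_C (k j : Fin 2) : S.D 0 * S.C 0 k j + S.D 1 * S.C 1 k j = S.B j k := by
  have h := S.eb_de_g j k
  rw [← C_g, ← C_g] at h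
  linear_combination h - S.C 0 k j * S.eb_g 0 - S.C 1 k j * S.eb_g 1

/-! ### Commutators -/

lemma delta_de (j k : Fin 2) (f : R) :
    S.delta j (S.de k f)
      = S.de k (S.delta j f) + (S.G 0 k j * S.de 0 f + S.G 1 k j * S.de 1 f) := by
  simp only [delta_apply, Derivation.leibniz, map_add, map_sub, smul_eq_mul, S.dz_de, de_N,
    S.de_de k]
  ring
lemma delta_deb (j k : Fin 2) (f : R) :
    S.delta j (S.deb k f) = S.deb k (S.delta j f)
      + (S.deb k (S.N 0 j) * S.de 0 f + S.deb k (S.N 1 j) * S.de 1 f) := by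
  simp only [delta_apply, Derivation.leibniz, map_add, map_sub, smul_eq_mul, S.dz_deb, S.de_deb]
  ring
lemma delta_deltab (j k : Fin 2) (f : R) :
    S.delta j (S.deltab k f) = S.deltab k (S.delta j f)
      + (S.deltab k (S.N 0 j) * S.de 0 f + S.deltab k (S.N 1 j) * S.de 1 f)
      - (S.delta j (S.Nb 0 k) * S.deb 0 f + S.delta j (S.Nb 1 k) * S.deb 1 f) := by
  simp only [delta_apply, deltab_apply, Derivation.leibniz, map_add, map_sub, smul_eq_mul,
    S.dz_deb, S.de_deb, S.dz_dzb, S.dzb_de]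
  ring

/-! ### Curvature -/

/-- The contraction of the lowered curvature with `η̄` in the first index, see `eb_Rm`. -/
def R0 (j h k : Fin 2) : R := -(S.g j 0 * S.delta k (S.Nb 0 h) + S.g j 1 * S.delta k (S.Nb 1 h))

lemma Rm_eq (r j h k : Fin 2) :
    S.Rm r j h k = -(S.g 0 r * S.deltab h (S.G 0 j k) + S.g 1 r * S.deltab h (S.G 1 j k))
      - (S.deltab h (S.N 0 k) * S.de 0 (S.g j r) + S.deltab h (S.N 1 k) * S.de 1 (S.g j r)) := by
  simp only [Rm, curv, Fin.sum_univ_two]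
  rw [← C_g, ← C_g]; ring
lemma deltab_g (h i r : Fin 2) :
    S.deltab h (S.g i r) = S.Gb 0 r h * S.g i 0 + S.Gb 1 r h * S.g i 1 := by
  have := congrArg star (S.G_g r h i)
  simpa only [star_add, star_mul', star_G, star_g, star_delta, eq_comm] using this
lemma Rm_eq' (r j h k : Fin 2) :
    S.Rm r j h k = - S.deltab h (S.delta k (S.g j r))
      + ((S.Gb 0 r h * S.g 0 0 + S.Gb 1 r h * S.g 0 1) * S.G 0 j k
        + (S.Gb 0 r h * S.g 1 0 + S.Gb 1 r h * S.g 1 1) * S.G 1 j k)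
      - (S.deltab h (S.N 0 k) * S.de 0 (S.g j r) + S.deltab h (S.N 1 k) * S.de 1 (S.g j r)) := by
  have h1 := congrArg (S.deltab h) (S.G_g j k r)
  simp only [Derivation.leibniz, map_add, smul_eq_mul, deltab_g] at h1
  rw [Rm_eq]
  linear_combination -h1
-- Hermitian symmetry: in the form `Rm_eq'` the only asymmetric part is accounted for by the
-- commutator of `δ_k` and `δ_h̄` on `g`.
lemma star_Rm (r j h k : Fin 2) : star (S.Rm r j h k) = S.Rm j r k h := by
  rw [S.Rm_eq' r, S.Rm_eq' j]
  simp only [star_add, star_mul', star_sub, star_neg, star_deltab, star_delta, star_g, star_G,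
    star_Gb, star_N, star_de]
  have h1 := S.delta_deltab h k (S.g r j)
  linear_combination -h1
lemma eb_Rm (j h k : Fin 2) : S.eb 0 * S.Rm 0 j h k + S.eb 1 * S.Rm 1 j h k = S.R0 j h k := by
  have h1 := congrArg (S.deltab h) (S.D_G j k)
  simp only [Derivation.leibniz, map_add, smul_eq_mul, deltab_D] at h1
  have h2 := S.delta_deltab k h (S.D j)
  rw [deltab_D, map_zero] at h2
  have h3 : ∀ i, S.deb i (S.D j) = S.g j i := fun i => (S.de_deb _ _ _).symm
  rw [h3, h3] at h2
  have h4 : ∀ i, S.de i (S.D j) = S.B i j := fun i => rfl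
  rw [h4, h4] at h2
  rw [Rm_eq, Rm_eq, R0]
  linear_combination h2 - h1 - S.deltab h (S.G 0 j k) * S.eb_g 0
    - S.deltab h (S.G 1 j k) * S.eb_g 1 - S.deltab h (S.N 0 k) * S.eb_de_g 0 j
    - S.deltab h (S.N 1 k) * S.eb_de_g 1 j

/-! ### The frame -/

lemma star_Finv : star S.Finv = S.Finv := by
  have h := congrArg star S.F_mul_Finv
  rw [star_mul', star_F, star_one] at h
  linear_combination S.Finv * h - star S.Finv * S.F_mul_Finv
lemma star_sinv : star S.sinv = S.sinv := by
  have h := congrArg star S.s_mul_sinv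
  rw [star_mul', star_s, star_one] at h
  linear_combination S.sinv * h - star S.sinv * S.s_mul_sinv
lemma lD_eq (i : Fin 2) : S.lD i = S.D i * S.Finv := by
  simp only [lD, Fin.sum_univ_two, star_mul', star_Finv, star_eta]
  linear_combination S.Finv * S.eb_g i
lemma mU_zero : S.mU 0 = - S.D 1 * S.Finv * S.sinv := by simp [mU, lD_eq]
lemma mU_one : S.mU 1 = S.D 0 * S.Finv * S.sinv := by simp [mU, lD_eq]
lemma mUb_zero : S.mUb 0 = - S.Db 1 * S.Finv * S.sinv := by
  simp only [mUb, mU_zero, star_mul', star_neg, star_D, star_Finv, star_sinv]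
lemma mUb_one : S.mUb 1 = S.Db 0 * S.Finv * S.sinv := by
  simp only [mUb, mU_one, star_mul', star_D, star_Finv, star_sinv]
lemma mD_eq (i : Fin 2) : S.mD i = S.g i 0 * S.mUb 0 + S.g i 1 * S.mUb 1 := by
  simp only [mD, Fin.sum_univ_two, star_mU]
lemma mDb_eq (i : Fin 2) : S.mDb i = S.g 0 i * S.mU 0 + S.g 1 i * S.mU 1 := by
  simp only [mDb, mD_eq, star_add, star_mul', star_g, star_mUb]
lemma mD_zero : S.mD 0 = - S.eta 1 * S.s * S.Finv := by
  rw [mD_eq, mUb_zero, mUb_one]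
  linear_combination S.Finv * S.sinv * (S.g 0 0 * S.eta_g 1 - S.g 0 1 * S.eta_g 0)
    - S.eta 1 * S.Finv * S.sinv * S.det_g - S.eta 1 * S.Finv * S.s * S.s_mul_sinv
lemma mD_one : S.mD 1 = S.eta 0 * S.s * S.Finv := by
  rw [mD_eq, mUb_zero, mUb_one]
  linear_combination S.Finv * S.sinv * (S.g 1 0 * S.eta_g 1 - S.g 1 1 * S.eta_g 0)
    + S.eta 0 * S.Finv * S.sinv * S.det_g + S.eta 0 * S.Finv * S.s * S.s_mul_sinv
lemma L_Finv : S.L * S.Finv * S.Finv = 1 := by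
  rw [← F_mul_F]; linear_combination (S.F * S.Finv + 1) * S.F_mul_Finv
-- The square root of the determinant cancels in the projector `m^i m_j`, leaving only `η` and the
-- first derivatives of `L`.
lemma mU_mul_mD (i j : Fin 2) : S.L * (S.mU i * S.mD j)
    = ![- S.D 1, S.D 0] i * ![- S.eta 1, S.eta 0] j := by
  have e : S.L * S.Finv * S.Finv * (S.s * S.sinv) = 1 := by
    rw [L_Finv, s_mul_sinv, one_mul]
  revert i j
  refine Fin.forall_fin_two.2 ⟨Fin.forall_fin_two.2 ⟨?_, ?_⟩, Fin.forall_fin_two.2 ⟨?_, ?_⟩⟩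
  · simp [mU_zero, mD_zero]; linear_combination S.D 1 * S.eta 1 * e
  · simp [mU_zero, mD_one]; linear_combination S.D 1 * S.eta 0 * e
  · simp [mU_one, mD_zero]; linear_combination S.D 0 * S.eta 1 * e
  · simp [mU_one, mD_one]; linear_combination S.D 0 * S.eta 0 * e
lemma L_cancel {x y : R} (h : S.L * x = S.L * y) : x = y := by
  linear_combination S.Finv * S.Finv * h - (x - y) * S.L_Finv
/-- `l_j l^i + m_j m^i` is the identity. -/
lemma frame_complete (v : Fin 2 → R) (j : Fin 2) :
    v j = S.lD j * S.Finv * (S.eta 0 * v 0 + S.eta 1 * v 1)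
      + S.mD j * (S.mU 0 * v 0 + S.mU 1 * v 1) := by
  apply S.L_cancel
  have h0 := S.mU_mul_mD 0 j
  have h1 := S.mU_mul_mD 1 j
  rw [lD_eq]
  have e := S.eta_D
  have f := S.L_Finv
  revert j
  refine Fin.forall_fin_two.2 ⟨?_, ?_⟩ <;> intro h0 h1 <;> simp at h0 h1
  · linear_combination -v 0 * h0 - v 1 * h1 - v 0 * e
      - S.D 0 * (S.eta 0 * v 0 + S.eta 1 * v 1) * f
  · linear_combination -v 0 * h0 - v 1 * h1 - v 1 * e
      - S.D 1 * (S.eta 0 * v 0 + S.eta 1 * v 1) * f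
lemma mU_D : S.mU 0 * S.D 0 + S.mU 1 * S.D 1 = 0 := by
  rw [mU_zero, mU_one]; ring
lemma mU_mD : S.mU 0 * S.mD 0 + S.mU 1 * S.mD 1 = 1 := by
  rw [mU_zero, mU_one, mD_zero, mD_one]
  linear_combination S.s * S.sinv * S.Finv * S.Finv * S.eta_D + S.s * S.sinv * S.L_Finv
    + S.s_mul_sinv
lemma eta_mD : S.eta 0 * S.mD 0 + S.eta 1 * S.mD 1 = 0 := by
  rw [mD_zero, mD_one]; ring
lemma eb_mDb : S.eb 0 * S.mDb 0 + S.eb 1 * S.mDb 1 = 0 := by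
  have := congrArg star S.eta_mD
  simpa only [star_add, star_mul', star_eta, star_mD, star_zero] using this
lemma mUb_mDb : S.mUb 0 * S.mDb 0 + S.mUb 1 * S.mDb 1 = 1 := by
  have := congrArg star S.mU_mD
  simpa only [star_add, star_mul', star_mU, star_mD, star_one] using this

lemma A_eq : S.A = S.Finv * (S.mU 0 * (S.mU 0 * S.B 0 0 + S.mU 1 * S.B 0 1)
    + S.mU 1 * (S.mU 0 * S.B 1 0 + S.mU 1 * S.B 1 1)) := by
  simp only [A, Fin.sum_univ_two, lD_eq]
  linear_combination S.Finv * (S.mU 0 * S.mU 0 * S.D_C 0 0 + S.mU 0 * S.mU 1 * S.D_C 1 0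
    + S.mU 1 * S.mU 0 * S.D_C 0 1 + S.mU 1 * S.mU 1 * S.D_C 1 1)
-- The Hessian annihilates `η` in both slots, so only its `m`-`m` component survives in the frame,
-- and that component is `F A`.
lemma B_eq (i j : Fin 2) : S.B i j = S.F * S.A * S.mD i * S.mD j := by
  have h := S.frame_complete (fun i => S.B i j) i
  have hk := fun k => S.frame_complete (fun j => S.B k j) j
  have h' : ∀ k, S.eta 0 * S.B k 0 + S.eta 1 * S.B k 1 = 0 := fun k => by
    rw [S.B_symm k 0, S.B_symm k 1, eta_B]
  have h0 := hk 0
  have h1 := hk 1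
  simp only [eta_B, h'] at h h0 h1
  rw [A_eq]
  linear_combination h + S.mD i * S.mU 0 * h0 + S.mD i * S.mU 1 * h1
    - S.mD i * S.mD j * (S.mU 0 * (S.mU 0 * S.B 0 0 + S.mU 1 * S.B 0 1)
      + S.mU 1 * (S.mU 0 * S.B 1 0 + S.mU 1 * S.B 1 1)) * S.F_mul_Finv
lemma Bb_eq (i j : Fin 2) : S.Bb i j = S.F * S.Ab * S.mDb i * S.mDb j := by
  rw [← star_B, B_eq]
  simp only [star_mul', star_F, star_A, star_mD]

lemma deltab_F (h : Fin 2) : S.deltab h S.F = 0 := by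
  have h1 := S.deltab_L h
  rw [← F_mul_F, Derivation.leibniz, smul_eq_mul] at h1
  refine S.two_cancel _ ?_
  linear_combination S.Finv * h1 - 2 * S.deltab h S.F * S.F_mul_Finv
lemma deltab_Finv (h : Fin 2) : S.deltab h S.Finv = 0 := by
  have h1 := congrArg (S.deltab h) S.F_mul_Finv
  rw [Derivation.leibniz, smul_eq_mul, smul_eq_mul, deltab_F, Derivation.map_one_eq_zero] at h1
  linear_combination S.Finv * h1 - S.deltab h S.Finv * S.F_mul_Finv
-- The usual rule that the logarithmic derivative of a determinant is the trace of the connection.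
lemma deltab_s_mul_s (h : Fin 2) : S.deltab h (S.s * S.s) = S.s * S.s * S.trb h := by
  rw [← det_g]
  simp only [Derivation.leibniz, map_sub, smul_eq_mul, deltab_g, trb, tr, star_add, star_G]
  ring
lemma two_deltab_s (h : Fin 2) : 2 * S.deltab h S.s = S.s * S.trb h := by
  have h1 := S.deltab_s_mul_s h
  rw [Derivation.leibniz, smul_eq_mul] at h1
  linear_combination S.sinv * h1 + (S.s * S.trb h - 2 * S.deltab h S.s) * S.s_mul_sinv
lemma two_deltab_sinv (h : Fin 2) : 2 * S.deltab h S.sinv = - S.sinv * S.trb h := by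
  have h1 := congrArg (S.deltab h) S.s_mul_sinv
  have h2 := S.two_deltab_s h
  rw [Derivation.leibniz, smul_eq_mul, smul_eq_mul, Derivation.map_one_eq_zero] at h1
  linear_combination 2 * S.sinv * h1 - S.sinv * S.sinv * h2
    + (- S.sinv * S.trb h - 2 * S.deltab h S.sinv) * S.s_mul_sinv

end FinslerRing

namespace FinslerRing

variable {R : Type*} [CommRing R] [StarRing R] (S : FinslerRing R)

/-! ### Derivatives of the frame and of the Hessian -/

include S in
lemma two_inj {x y : R} (h : 2 * x = 2 * y) : x = y :=
  sub_eq_zero.1 (S.two_cancel _ (by linear_combination h))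

lemma two_deltab_mD (h j : Fin 2) : 2 * S.deltab h (S.mD j) = S.mD j * S.trb h := by
  have e := S.two_deltab_s h
  revert j
  refine Fin.forall_fin_two.2 ⟨?_, ?_⟩
  · rw [mD_zero]
    simp only [Derivation.leibniz, map_neg, smul_eq_mul, deltab_Finv, deltab_eta]
    linear_combination - S.eta 1 * S.Finv * e
  · rw [mD_one]
    simp only [Derivation.leibniz, smul_eq_mul, deltab_Finv, deltab_eta]
    linear_combination S.eta 0 * S.Finv * e
-- Each factor `m_i` contributes half of the conjugate trace, so together they complete `A_{|h̄}` to
-- `X_h`.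
lemma deltab_B (h i j : Fin 2) : S.deltab h (S.B i j) = S.F * S.mD i * S.mD j * S.X h := by
  apply S.two_inj
  rw [B_eq, X]
  simp only [Derivation.leibniz, smul_eq_mul, deltab_F]
  linear_combination S.F * S.A * S.mD i * S.two_deltab_mD h j
    + S.F * S.A * S.mD j * S.two_deltab_mD h i
-- Lowered by `g`, this is the conjugate of `deb_N_g`, whose right side is a horizontal derivative
-- of the Hessian and so is given by `deltab_B`.
lemma de_Nb (n i k : Fin 2) : S.de n (S.Nb i k) = S.F * S.mD n * S.X k * S.mUb i := by
  refine S.g_cancel' (fun i => S.de n (S.Nb i k)) (fun i => S.F * S.mD n * S.X k * S.mUb i)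
    (fun m => ?_) i
  have h := congrArg star (S.deb_N_g n k m)
  simp only [star_add, star_mul', star_deb, star_N, star_g, star_delta] at h
  rw [← star_B, star_star, deltab_B] at h
  linear_combination h + S.F * S.mD n * S.X k * S.mD_eq m
lemma deb_N (n i k : Fin 2) : S.deb n (S.N i k) = S.F * S.mDb n * S.Xb k * S.mU i := by
  have h := congrArg star (S.de_Nb n i k)
  simpa only [star_de, star_mul', star_Nb, star_F, star_mD, star_X, star_mUb] using h
lemma deb_Nb (n i k : Fin 2) : S.deb n (S.Nb i k) = S.Gb i n k := by
  rw [Nb, ← star_de, de_N, star_G]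
lemma mU_B (k : Fin 2) : S.mU 0 * S.B 0 k + S.mU 1 * S.B 1 k = S.F * S.A * S.mD k := by
  rw [B_eq, B_eq]
  linear_combination S.F * S.A * S.mD k * S.mU_mD
lemma eta_Xb : S.eta 0 * S.Xb 0 + S.eta 1 * S.Xb 1 = S.Phb := by
  simp only [Phb, Ph, star_add, star_mul', star_eb, star_X]
lemma Nb_g (h n : Fin 2) :
    S.Nb 0 h * S.g n 0 + S.Nb 1 h * S.g n 1 = S.dzb h (S.D n) := by
  have := congrArg star (S.N_g h n)
  simpa only [star_add, star_mul', star_N, star_g, star_dz, star_Db] using this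
lemma Nb_Db (k : Fin 2) : S.Nb 0 k * S.Db 0 + S.Nb 1 k * S.Db 1 = S.dzb k S.L := by
  have := congrArg star (S.N_D k)
  simpa only [star_add, star_mul', star_N, star_D, star_dz, star_L] using this
lemma deb_D (n k : Fin 2) : S.deb n (S.D k) = S.g k n := (S.de_deb _ _ _).symm
lemma deltab_mU_mD (h i j : Fin 2) : S.deltab h (S.mU i * S.mD j) = 0 := by
  have e := congrArg (S.deltab h) (S.mU_mul_mD i j)
  have f : S.deltab h (![- S.D 1, S.D 0] i * ![- S.eta 1, S.eta 0] j) = 0 := by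
    revert i j
    refine Fin.forall_fin_two.2 ⟨Fin.forall_fin_two.2 ⟨?_, ?_⟩, Fin.forall_fin_two.2 ⟨?_, ?_⟩⟩ <;>
    · intro _; simp [Derivation.leibniz, deltab_D, deltab_eta]
  rw [f, Derivation.leibniz, deltab_L, smul_zero, add_zero, smul_eq_mul] at e
  apply S.L_cancel
  rw [e, mul_zero]

/-! ### Contractions of the curvature -/

/-- The contraction of the lowered curvature with `η̄` and `η` in the first two indices. -/
def D2 (n k : Fin 2) : R := S.eta 0 * S.R0 0 n k + S.eta 1 * S.R0 1 n k
/-- The contraction of the lowered curvature with `η̄`, `η`, `η̄` in the first three indices. -/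
def Q (k : Fin 2) : R := S.eb 0 * S.D2 0 k + S.eb 1 * S.D2 1 k
/-- The contraction of the lowered curvature with `η̄` in the first and third indices. -/
def P (n m : Fin 2) : R := S.eb 0 * S.R0 n 0 m + S.eb 1 * S.R0 n 1 m
/-- The total contraction of the curvature. -/
def Qq : R := S.eta 0 * S.Q 0 + S.eta 1 * S.Q 1

lemma D2_eq (n k : Fin 2) : S.D2 n k = - S.delta k (S.dzb n S.L) := by
  rw [← Nb_Db]
  simp only [Derivation.leibniz, map_add, smul_eq_mul, delta_Db, D2, R0]
  linear_combination - S.delta k (S.Nb 0 n) * S.eta_g 0 - S.delta k (S.Nb 1 n) * S.eta_g 1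
lemma star_D2 (n k : Fin 2) : star (S.D2 n k) = S.D2 k n := by
  rw [D2_eq, D2_eq, star_neg, star_delta, star_dzb, star_L, ← N_D, ← Nb_Db]
  have h := S.delta_deltab n k S.L
  rw [deltab_L, delta_L, map_zero, map_zero] at h
  simp only [Derivation.leibniz, map_add, smul_eq_mul, delta_Db, deltab_D]
  simp only [D, Db]
  linear_combination h
-- Since `D2` is `-δ_k` of `∂L/∂z̄^n`, the commutator `delta_de` applies; its connection term
-- cancels the one produced by differentiating `g`.
lemma de_D2 (l n k : Fin 2) : S.de l (S.D2 n k) = S.R0 l n k := by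
  have h1 := S.delta_de k l (S.dzb n S.L)
  have h2 : ∀ i, S.de i (S.dzb n S.L) = S.Nb 0 n * S.g i 0 + S.Nb 1 n * S.g i 1 := fun i => by
    rw [Nb_g, D, dzb_de]
  simp only [h2, Derivation.leibniz, map_add, smul_eq_mul, ← G_g] at h1
  rw [D2_eq, R0, map_neg]
  linear_combination h1
lemma de_Q (n m : Fin 2) : S.de n (S.Q m) = S.P n m := by
  have h := S.de_contract_eb (fun i => S.D2 i m) n
  rw [de_D2, de_D2] at h
  exact h
lemma star_Q (n : Fin 2) : star (S.Q n) = S.eta 0 * S.D2 n 0 + S.eta 1 * S.D2 n 1 := by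
  simp only [Q, star_add, star_mul', star_eb, star_D2]
lemma star_Qq : star S.Qq = S.Qq := by
  simp only [Qq, star_add, star_mul', star_eta, star_Q]
  simp only [Q]; ring

/-- Moving the fibre derivative past `δ_k` in `δ_k N̄` yields the conjugate connection coefficients,
hence the curvature, plus a product of two mixed derivatives of `N`, which is quadratic in `X`. -/
lemma deb_R0 (r j h k : Fin 2) :
    S.deb r (S.R0 j h k) = S.Rm r j h k + S.L * S.mDb r * S.mD j * S.Xb k * S.X h := by
  rw [← star_Rm, Rm_eq]
  simp only [star_sub, star_neg, star_add, star_mul', star_g, star_deltab, star_G, star_N,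
    star_de]
  have e : ∀ i, S.deb r (S.g j i) = S.deb i (S.g j r) := fun i => by
    rw [g, g, ← de_deb, ← de_deb, deb_deb]
  have h0 := S.delta_deb k r (S.Nb 0 h)
  have h1 := S.delta_deb k r (S.Nb 1 h)
  simp only [deb_Nb, de_Nb, deb_N] at h0 h1
  simp only [R0, map_neg, map_add, Derivation.leibniz, smul_eq_mul, e]
  rw [← F_mul_F]
  linear_combination S.g j 0 * h0 + S.g j 1 * h1
    + S.F * S.F * S.mDb r * S.Xb k * S.X h * (S.mD j * S.mU_mD
      - (S.mU 0 * S.mD 0 + S.mU 1 * S.mD 1) * S.mD_eq j)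

/-! ### The curvature of special metrics -/

/-- The hypotheses on the metric: it is weakly Kähler with weakly symmetric curvature, `A` is
regular, and `Φ` is horizontally constant relative to the determinant of the metric. -/
structure IsSpecial : Prop where
  wk : ∀ k, ∑ i, ∑ l, ∑ j, S.g i l * (S.G i j k - S.G i k j) * S.eta j * S.eb l = 0
  ws : ∀ k, ∑ r, ∑ h, ∑ s, S.Rm r k h s * S.eb r * S.eb h * S.eta s
    = ∑ r, ∑ j, ∑ h, S.Rm r j h k * S.eb r * S.eta j * S.eb h
  reg : ∀ x, S.A * x = 0 → x = 0
  phi : ∀ k, S.delta k S.Ph = S.Ph * S.tr k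

variable {S}

lemma F_cancel {x : R} (h : S.F * x = 0) : x = 0 := by
  linear_combination S.Finv * h - x * S.F_mul_Finv

/-! ### Consequences of weak Kähler and weak symmetry. -/

namespace IsSpecial

variable (H : S.IsSpecial)
include H

/-- The form in which the weak Kähler condition is used: both sides are contractions of connection
coefficients with `∂L/∂η^i` and `η`, differing by the order of the lower indices. -/
lemma dz_L (k : Fin 2) :
    S.dz k S.L = S.eta 0 * S.delta 0 (S.D k) + S.eta 1 * S.delta 1 (S.D k) := by
  have h := H.wk k
  simp only [Fin.sum_univ_two] at h
  have e0 := S.G_eta 0 k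
  have e1 := S.G_eta 1 k
  have f0 := S.eb_g 0
  have f1 := S.eb_g 1
  rw [← N_D, ← D_G, ← D_G]
  rw [← e0, ← e1, ← f0, ← f1]
  linear_combination h
lemma dzb_L (k : Fin 2) :
    S.dzb k S.L = S.eb 0 * S.deltab 0 (S.Db k) + S.eb 1 * S.deltab 1 (S.Db k) := by
  have := congrArg star (H.dz_L k)
  simpa only [star_add, star_mul', star_dz, star_L, star_eta, star_delta, star_D] using this
-- The `η̄`-derivative of the weak Kähler condition removes one contraction. The error term comes
-- from the mixed derivatives of `N`, whence `Φ̄ A`.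
lemma torsion_eta (i k : Fin 2) : S.eta 0 * S.G i k 0 + S.eta 1 * S.G i k 1 - S.N i k
    = S.L * (S.mU i * S.mD k) * (S.Phb * S.A) := by
  refine S.g_cancel (fun i => S.eta 0 * S.G i k 0 + S.eta 1 * S.G i k 1 - S.N i k)
    (fun i => S.L * (S.mU i * S.mD k) * (S.Phb * S.A)) (fun n => ?_) i
  have h := congrArg (S.deb n) (H.dz_L k)
  rw [← dz_deb, S.deb_contract (fun j => S.delta j (S.D k))] at h
  have e0 := S.delta_deb 0 n (S.D k)
  have e1 := S.delta_deb 1 n (S.D k)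
  rw [deb_D, ← G_g, deb_N, deb_N] at e0 e1
  have hb : ∀ i, S.de i (S.D k) = S.B i k := fun i => rfl
  rw [hb, hb] at e0 e1
  have e2 := S.N_g k n
  have e3 := S.mU_B k
  have e4 := S.mDb_eq n
  have e5 := S.eta_Xb
  change S.dz k (S.Db n) = _ at h
  rw [← F_mul_F]
  linear_combination S.eta 0 * e0 + S.eta 1 * e1 - e2 - h
    + S.F * S.mDb n * (S.eta 0 * S.Xb 0 + S.eta 1 * S.Xb 1) * e3
    + S.F * S.F * S.A * S.mD k * S.mDb n * e5
    + S.F * S.F * S.A * S.mD k * S.Phb * e4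
lemma eta_P (k : Fin 2) : S.eta 0 * S.P k 0 + S.eta 1 * S.P k 1 = S.Q k := by
  have h := H.ws k
  simp only [Fin.sum_univ_two] at h
  simp only [P, Q, D2, ← eb_Rm]
  linear_combination h
lemma de_Qq (m : Fin 2) : S.de m S.Qq = 2 * S.Q m := by
  have h := S.de_contract S.Q m
  rw [de_Q, de_Q] at h
  rw [Qq, h]
  linear_combination H.eta_P m
-- `Q_m` is `-δ_m` applied to `η̄^h ∂L/∂z̄^h`. The weak Kähler condition computes the
-- `η̄`-derivative of that function, and the rest is the commutator `delta_deb`.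
lemma deb_Q (n m : Fin 2) : S.deb n (S.Q m)
    = 2 * S.D2 n m + S.F * S.Ab * S.mDb n * (S.mU 0 * S.P 0 m + S.mU 1 * S.P 1 m) := by
  have hQ : S.delta m (S.eb 0 * S.dzb 0 S.L + S.eb 1 * S.dzb 1 S.L) = - S.Q m := by
    rw [S.delta_contract_eb (fun i => S.dzb i S.L), Q, D2_eq, D2_eq]; ring
  have h1 := S.delta_deb m n (S.eb 0 * S.dzb 0 S.L + S.eb 1 * S.dzb 1 S.L)
  have h2 : S.deb n (S.eb 0 * S.dzb 0 S.L + S.eb 1 * S.dzb 1 S.L)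
      = 2 * S.dzb n S.L + (S.eb 0 * (S.Nb 0 0 * S.Bb n 0 + S.Nb 1 0 * S.Bb n 1)
        + S.eb 1 * (S.Nb 0 1 * S.Bb n 0 + S.Nb 1 1 * S.Bb n 1)) := by
    rw [S.deb_contract_eb (fun i => S.dzb i S.L)]
    have h := H.dzb_L n
    simp only [deltab_apply] at h
    have hb : ∀ i, S.deb i (S.Db n) = S.Bb n i := fun i => S.deb_deb _ _ _
    simp only [hb] at h
    have hc : ∀ i, S.deb n (S.dzb i S.L) = S.dzb i (S.Db n) := fun i => (S.dzb_deb _ _ _).symm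
    simp only [hc]
    linear_combination -h
  have h3 : ∀ i, S.de i (S.eb 0 * S.dzb 0 S.L + S.eb 1 * S.dzb 1 S.L)
      = S.eb 0 * (S.Nb 0 0 * S.g i 0 + S.Nb 1 0 * S.g i 1)
        + S.eb 1 * (S.Nb 0 1 * S.g i 0 + S.Nb 1 1 * S.g i 1) := fun i => by
    rw [S.de_contract_eb (fun i => S.dzb i S.L), Nb_g, Nb_g, ← dzb_de, ← dzb_de, D]
  rw [h2, h3, h3, hQ] at h1
  simp only [map_add, map_neg, Derivation.leibniz, smul_eq_mul, delta_eb, two_mul] at h1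
  have g0 := S.deb_N_g n m 0
  have g1 := S.deb_N_g n m 1
  have b0 := S.Bb_eq n 0
  have b1 := S.Bb_eq n 1
  rw [S.mDb_eq 0] at b0
  rw [S.mDb_eq 1] at b1
  rw [D2_eq]
  simp only [P, R0]
  linear_combination h1
    + (S.eb 0 * S.Nb 0 0 + S.eb 1 * S.Nb 0 1) * g0
    + (S.eb 0 * S.Nb 1 0 + S.eb 1 * S.Nb 1 1) * g1
    - (S.eb 0 * S.delta m (S.Nb 0 0) + S.eb 1 * S.delta m (S.Nb 0 1)) * b0
    - (S.eb 0 * S.delta m (S.Nb 1 0) + S.eb 1 * S.delta m (S.Nb 1 1)) * b1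
lemma reg_b {x : R} (h : S.Ab * x = 0) : x = 0 := by
  have := congrArg star h
  rw [star_mul', star_Ab, star_zero] at this
  simpa using congrArg star (H.reg _ this)
-- The total contraction `Qq` is real, so its `η̄`-derivative is `2 Q̄_n` by `de_Qq`. Computed from
-- `deb_Q`, it has the extra term `F Ā m̄_n m^j Q_j`, which must vanish.
lemma mU_Q : S.mU 0 * S.Q 0 + S.mU 1 * S.Q 1 = 0 := by
  have key : ∀ n, S.F * S.Ab * S.mDb n * (S.mU 0 * S.Q 0 + S.mU 1 * S.Q 1) = 0 := fun n => by
    have h := S.deb_contract S.Q n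
    have h2 := congrArg star (H.de_Qq n)
    rw [star_de, star_Qq, star_mul', star_Q, star_ofNat, Qq, h, H.deb_Q, H.deb_Q] at h2
    have p0 := H.eta_P 0
    have p1 := H.eta_P 1
    linear_combination h2 - S.F * S.Ab * S.mDb n * (S.mU 0 * p0 + S.mU 1 * p1)
  apply H.reg_b
  apply F_cancel (S := S)
  linear_combination S.mUb 0 * key 0 + S.mUb 1 * key 1
    - S.F * S.Ab * (S.mU 0 * S.Q 0 + S.mU 1 * S.Q 1) * S.mUb_mDb

end IsSpecial

/-- Half the holomorphic sectional curvature in the direction of `η`. -/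
def kappa (S : FinslerRing R) : R := S.Finv * S.Finv * (S.Finv * S.Finv) * S.Qq

lemma star_kappa : star S.kappa = S.kappa := by
  simp only [kappa, star_mul', star_Finv, star_Qq]
lemma L_L_kappa : S.L * S.L * S.kappa = S.Qq := by
  rw [kappa]
  linear_combination S.Qq * (S.L * S.Finv * S.Finv + 1) * S.L_Finv

/-! ### Vanishing of the contracted curvature. -/

namespace IsSpecial

variable (H : S.IsSpecial)
include H

lemma Q_eq (j : Fin 2) : S.Q j = S.D j * S.L * S.kappa := by
  have h := S.frame_complete S.Q j
  rw [H.mU_Q, lD_eq] at h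
  change _ = _ * S.Qq + _ at h
  rw [← L_L_kappa] at h
  linear_combination h + S.D j * S.L * S.kappa * S.L_Finv
-- Differentiating `Qq = L² κ` already gives `2 Q_j` from the factor `L²`, so nothing is left for
-- `κ`.
lemma de_kappa (j : Fin 2) : S.de j S.kappa = 0 := by
  have h := congrArg (S.de j) (S.L_L_kappa)
  rw [H.de_Qq, H.Q_eq] at h
  simp only [Derivation.leibniz, smul_eq_mul] at h
  apply S.L_cancel
  apply S.L_cancel
  rw [D] at h
  linear_combination h
lemma deb_kappa (j : Fin 2) : S.deb j S.kappa = 0 := by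
  rw [← star_kappa, ← star_de, H.de_kappa, star_zero]
lemma P_eq (n m : Fin 2) : S.P n m = S.kappa * (S.B n m * S.L + S.D n * S.D m) := by
  rw [← de_Q, H.Q_eq]
  simp only [Derivation.leibniz, smul_eq_mul, H.de_kappa, B, D]
  ring
lemma deb_Q' (n m : Fin 2) :
    S.deb n (S.Q m) = S.kappa * (S.g m n * S.L + S.D m * S.Db n) := by
  rw [H.Q_eq]
  simp only [Derivation.leibniz, smul_eq_mul, H.deb_kappa, deb_D]
  simp only [Db]
  ring
lemma two_D2 (n m : Fin 2) : 2 * S.D2 n m = S.kappa * (S.g m n * S.L + S.D m * S.Db n)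
    - S.kappa * S.L * S.L * S.A * S.Ab * S.mDb n * S.mD m := by
  have h := H.deb_Q n m
  rw [H.deb_Q', H.P_eq, H.P_eq] at h
  linear_combination -h
    - S.F * S.Ab * S.mDb n * S.kappa * (S.L * S.mU_B m + S.D m * S.mU_D)
    - S.kappa * S.L * S.A * S.Ab * S.mDb n * S.mD m * S.F_mul_F
-- The only use of the condition on `Φ`: its trace term cancels the one hidden in `X_h`.
lemma deltab_Phb_mul_A (h : Fin 2) : S.deltab h (S.Phb * S.A) = S.Phb * S.X h := by
  have e := congrArg star (H.phi h)
  rw [star_delta, star_mul', star_Ph, star_tr] at e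
  rw [Derivation.leibniz, smul_eq_mul, smul_eq_mul, e, X]
  ring
lemma eta_deltab_N (h l : Fin 2) :
    S.eta 0 * S.deltab h (S.N l 0) + S.eta 1 * S.deltab h (S.N l 1)
      = - S.kappa * (S.eta l * S.Db h + S.L * S.F * S.Ab * S.mDb h * S.mU l) := by
  refine S.g_cancel
    (fun l => S.eta 0 * S.deltab h (S.N l 0) + S.eta 1 * S.deltab h (S.N l 1))
    (fun l => - S.kappa * (S.eta l * S.Db h + S.L * S.F * S.Ab * S.mDb h * S.mU l))
    (fun r => ?_) l
  have e := congrArg star (H.P_eq r h)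
  simp only [P, R0, star_add, star_mul', star_neg, star_eb, star_g, star_delta, star_Nb,
    star_kappa, star_B, star_L, star_D] at e
  rw [Bb_eq] at e
  linear_combination -e + S.kappa * S.Db h * S.eta_g r
    - S.kappa * S.L * S.F * S.Ab * S.mDb h * S.mDb_eq r
-- Apply `δ_h̄` to `torsion_eta`: since `δ_h̄ η = 0` and `m^i m_k` is constant for `δ_h̄`,
-- contracting the last index exchanges it with the second, up to the `Φ̄ X_h` term and a `κ` term.
lemma Rm_eta (r k h : Fin 2) : S.eta 0 * S.Rm r k h 0 + S.eta 1 * S.Rm r k h 1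
    = star (S.R0 r k h) - S.L * S.mDb r * S.mD k * S.Phb * S.X h
      + S.kappa * S.L * S.F * S.Ab * S.mDb h
        * (S.mU 0 * S.de 0 (S.g k r) + S.mU 1 * S.de 1 (S.g k r)) := by
  have t : ∀ i, S.eta 0 * S.deltab h (S.G i k 0) + S.eta 1 * S.deltab h (S.G i k 1)
      - S.deltab h (S.N i k) = S.L * (S.mU i * S.mD k) * (S.Phb * S.X h) := fun i => by
    have e := congrArg (S.deltab h) (H.torsion_eta i k)
    rw [map_sub, S.deltab_contract (fun j => S.G i k j), Derivation.leibniz,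
      H.deltab_Phb_mul_A, Derivation.leibniz, deltab_mU_mD, deltab_L] at e
    rw [e]
    simp only [smul_eq_mul]; ring
  simp only [Rm_eq, R0, star_add, star_mul', star_neg, star_g, star_delta, star_Nb]
  linear_combination - S.g 0 r * t 0 - S.g 1 r * t 1
    - S.de 0 (S.g k r) * H.eta_deltab_N h 0 - S.de 1 (S.g k r) * H.eta_deltab_N h 1
    + S.kappa * S.Db h * S.eta_de_g k r
    + S.L * S.mD k * S.Phb * S.X h * S.mDb_eq r
lemma R0_eta (k h : Fin 2) : S.eta 0 * S.R0 k h 0 + S.eta 1 * S.R0 k h 1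
    = S.D2 h k + S.kappa * S.L * S.L * S.A * S.Ab * S.mDb h * S.mD k := by
  have e0 := H.Rm_eta 0 k h
  have e1 := H.Rm_eta 1 k h
  have d : S.eb 0 * star (S.R0 0 k h) + S.eb 1 * star (S.R0 1 k h) = S.D2 h k := by
    rw [← star_D2 S k h]
    simp only [D2, star_add, star_mul', star_eta]
  rw [← eb_Rm, ← eb_Rm]
  linear_combination S.eb 0 * e0 + S.eb 1 * e1 + d
    - S.L * S.mD k * S.Phb * S.X h * S.eb_mDb
    + S.kappa * S.L * S.F * S.Ab * S.mDb h * (S.mU 0 * S.eb_de_g 0 k + S.mU 1 * S.eb_de_g 1 k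
      + S.mU_B k)
    + S.kappa * S.L * S.A * S.Ab * S.mDb h * S.mD k * S.F_mul_F
-- The `η̄^r`-derivative of `eta_P` contains two contractions of `R0`, each exceeding `D2` by `κ L²
-- |A|² m̄_r m_k`, while `two_D2` falls short by only one such term. The `X` terms cancel.
lemma kappa_eq_zero : S.kappa = 0 := by
  have key : ∀ r k, S.kappa * S.L * S.L * S.A * S.Ab * S.mDb r * S.mD k = 0 := fun r k => by
    have e0 := H.Rm_eta r k 0
    have e1 := H.Rm_eta r k 1
    have f := congrArg (S.deb r) (H.eta_P k)
    rw [S.deb_contract (fun s => S.P k s), H.deb_Q'] at f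
    have f0 := S.deb_contract_eb (fun h => S.R0 k h 0) r
    have f1 := S.deb_contract_eb (fun h => S.R0 k h 1) r
    change S.deb r (S.P k 0) = _ at f0
    change S.deb r (S.P k 1) = _ at f1
    simp only [deb_R0] at f0 f1
    have d := congrArg star (H.R0_eta r k)
    simp only [star_add, star_mul', star_eta, star_D2, star_kappa, star_L, star_A, star_Ab,
      star_mDb, star_mD] at d
    have d' := H.R0_eta k r
    have w := H.two_D2 r k
    have y := S.eta_Xb
    have z := S.eb_mDb
    linear_combination - S.eb 0 * e0 - S.eb 1 * e1 - S.eta 0 * f0 - S.eta 1 * f1 + f - d - d' - w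
      - S.L * S.mDb r * S.mD k * (S.eb 0 * S.X 0 + S.eb 1 * S.X 1) * y
      - S.kappa * S.L * S.F * S.Ab * (S.mU 0 * S.de 0 (S.g k r) + S.mU 1 * S.de 1 (S.g k r)) * z
  apply H.reg
  apply H.reg_b
  apply S.L_cancel
  apply S.L_cancel
  linear_combination S.mUb 0 * (S.mU 0 * key 0 0 + S.mU 1 * key 0 1)
    + S.mUb 1 * (S.mU 0 * key 1 0 + S.mU 1 * key 1 1)
    - S.kappa * S.L * S.L * S.A * S.Ab * ((S.mU 0 * S.mD 0 + S.mU 1 * S.mD 1) * S.mUb_mDb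
      + S.mU_mD)
-- With `κ = 0` the contraction `P` vanishes. Its `η̄^n`-derivative, by `deb_R0` and the conjugate
-- of `Rm_eta`, is `2 R0`, since the `Φ X̄_k` terms cancel.
lemma R0_eq_zero (j n k : Fin 2) : S.R0 j n k = 0 := by
  apply S.two_cancel
  have hk := H.kappa_eq_zero
  have f := S.deb_contract_eb (fun h => S.R0 j h k) n
  have p := H.P_eq j k
  rw [hk, zero_mul] at p
  change S.deb n (S.P j k) = _ at f
  rw [p, map_zero] at f
  simp only [deb_R0] at f
  have e := congrArg star (H.Rm_eta j n k)
  rw [hk] at e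
  simp only [star_add, star_sub, star_mul', star_star, star_eta, star_Rm, star_L, star_mDb,
    star_mD, star_Phb, star_X, zero_mul, add_zero] at e
  have x : S.eb 0 * S.X 0 + S.eb 1 * S.X 1 = S.Ph := rfl
  linear_combination -f - e - S.L * S.mDb n * S.mD j * S.Xb k * x
/-- The curvature is determined by the tensor `X`. -/
lemma Rm_formula (r j h k : Fin 2) :
    S.Rm r j h k = - S.L * S.mDb r * S.mD j * S.Xb k * S.X h := by
  have e := S.deb_R0 r j h k
  rw [H.R0_eq_zero, map_zero] at e
  linear_combination -e

end IsSpecial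

end FinslerRing

namespace FinslerRing

variable {R : Type*} [CommRing R] [StarRing R] (S : FinslerRing R)

/-! ### The coefficients of the connection in the frame -/

/-- `l^i` -/
def lU (i : Fin 2) : R := S.eta i * S.Finv
/-- the coefficient `J` -/
def cJ : R := ∑ i, ∑ j, ∑ k, S.lU j * S.lU k * S.lD i * S.G i j k
/-- the coefficient `V` -/
def cV : R := ∑ i, ∑ j, ∑ k, S.lU j * S.mU k * S.lD i * S.G i j k
/-- the coefficient `Y` -/
def cY : R := ∑ i, ∑ j, ∑ k, S.mU j * S.lU k * S.mD i * S.G i j k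
/-- the coefficient `H` -/
def cH : R := ∑ i, ∑ j, ∑ k, S.mU j * S.mU k * S.mD i * S.G i j k

lemma frame_trace (T : Fin 2 → Fin 2 → R) :
    T 0 0 + T 1 1 = ∑ i, ∑ j, (S.lU j * S.lD i + S.mU j * S.mD i) * T i j := by
  simp only [Fin.sum_univ_two, lU]
  linear_combination S.frame_complete (T 0) 0 + S.frame_complete (T 1) 1
lemma J_add_Y : S.cJ + S.cY = S.lU 0 * S.tr 0 + S.lU 1 * S.tr 1 := by
  have h0 := S.frame_trace (fun i j => S.G i j 0)
  have h1 := S.frame_trace (fun i j => S.G i j 1)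
  simp only [cJ, cY, Fin.sum_univ_two, tr] at *
  linear_combination - S.lU 0 * h0 - S.lU 1 * h1
lemma V_add_H : S.cV + S.cH = S.mU 0 * S.tr 0 + S.mU 1 * S.tr 1 := by
  have h0 := S.frame_trace (fun i j => S.G i j 0)
  have h1 := S.frame_trace (fun i j => S.G i j 1)
  simp only [cV, cH, Fin.sum_univ_two, tr] at *
  linear_combination - S.mU 0 * h0 - S.mU 1 * h1
-- `J + Y` and `V + H` are the frame components of the trace `L^i_{ik}`, so the bracket in the
-- condition on `Φ` is this trace.
lemma tr_eq (k : Fin 2) :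
    (S.cJ + S.cY) * S.lD k + (S.cV + S.cH) * S.mD k = S.tr k := by
  rw [J_add_Y, V_add_H]
  have h := S.frame_complete S.tr k
  simp only [lU]
  linear_combination -h
lemma Ph_eq : (∑ k, star (S.eta k) * S.deltab k S.A) + S.A * S.F * (star S.cJ + star S.cY)
    = S.Ph := by
  have h := congrArg star S.J_add_Y
  simp only [lU, star_add, star_mul', star_eta, star_Finv, star_tr] at h
  simp only [Fin.sum_univ_two, star_eta, Ph, X]
  linear_combination S.A * S.F * h
    + S.A * (S.eb 0 * S.trb 0 + S.eb 1 * S.trb 1) * S.F_mul_Finv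
lemma Om_eq : (∑ k, S.deltab k S.A * star (S.mU k)) + S.A * (star S.cV + star S.cH)
    = S.Om := by
  have h := congrArg star S.V_add_H
  simp only [star_add, star_mul', star_mU, star_tr] at h
  simp only [Fin.sum_univ_two, star_mU, Om, X]
  linear_combination S.A * h

variable {S}

/-! ### The two sectional curvatures and the constant case. -/

namespace IsSpecial

variable (H : S.IsSpecial)
include H

lemma secLambda_eq_zero :
    2 * ∑ r, ∑ j, ∑ h, ∑ k, S.Rm r j h k * star (S.lU r) * S.lU j * star (S.lU h) * S.lU k = 0 := by
  simp only [Fin.sum_univ_two, H.Rm_formula, lU, star_mul', star_eta, star_Finv]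
  linear_combination -2 * S.L * S.Finv * S.Finv * S.Finv * S.Finv
    * (S.eb 0 * S.mDb 0 + S.eb 1 * S.mDb 1) * (S.eb 0 * S.X 0 + S.eb 1 * S.X 1)
    * (S.eta 0 * S.Xb 0 + S.eta 1 * S.Xb 1) * S.eta_mD
lemma secMu_eq :
    2 * ∑ r, ∑ j, ∑ h, ∑ k, S.Rm r j h k * star (S.mU r) * S.mU j * star (S.mU h) * S.mU k
      = -2 * S.L * (S.Om * star S.Om) := by
  have e : S.Xb 0 * S.mU 0 + S.Xb 1 * S.mU 1 = star S.Om := by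
    simp only [Om, star_add, star_mul', star_X, star_mUb]
  rw [← e, Om]
  simp only [Fin.sum_univ_two, H.Rm_formula, star_mU]
  linear_combination -2 * S.L * (S.X 0 * S.mUb 0 + S.X 1 * S.mUb 1)
    * (S.Xb 0 * S.mU 0 + S.Xb 1 * S.mU 1)
    * ((S.mU 0 * S.mD 0 + S.mU 1 * S.mD 1) * S.mUb_mDb + S.mU_mD)

/-! ### Vanishing of `Ω` in the case of constant curvature -/

lemma delta_Nb (k i h : Fin 2) : S.delta k (S.Nb i h) = 0 := by
  refine S.g_cancel' (fun i => S.delta k (S.Nb i h)) (fun _ => 0) (fun j => ?_) i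
  have e := H.R0_eq_zero j h k
  rw [R0] at e
  linear_combination -e
lemma deltab_N (h i k : Fin 2) : S.deltab h (S.N i k) = 0 := by
  rw [← star_Nb, ← star_delta, H.delta_Nb, star_zero]
lemma delta_comm (j h : Fin 2) (f : R) :
    S.delta j (S.deltab h f) = S.deltab h (S.delta j f) := by
  rw [delta_deltab]
  simp only [H.delta_Nb, H.deltab_N]
  ring
lemma deltab_G (h i j k : Fin 2) :
    S.deltab h (S.G i j k) = S.L * S.mU i * S.mD j * S.Xb k * S.X h := by
  refine S.g_cancel (fun i => S.deltab h (S.G i j k))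
    (fun i => S.L * S.mU i * S.mD j * S.Xb k * S.X h) (fun r => ?_) i
  have e := H.Rm_formula r j h k
  rw [Rm_eq] at e
  simp only [H.deltab_N] at e
  linear_combination -e + S.L * S.mD j * S.Xb k * S.X h * S.mDb_eq r
lemma deltab_tr (h k : Fin 2) : S.deltab h (S.tr k) = S.L * S.Xb k * S.X h := by
  rw [tr, map_add, H.deltab_G, H.deltab_G]
  linear_combination S.L * S.Xb k * S.X h * S.mU_mD
lemma delta_trb (h k : Fin 2) : S.delta h (S.trb k) = S.L * S.X k * S.Xb h := by
  rw [trb, ← star_deltab, H.deltab_tr]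
  simp only [star_mul', star_L, star_X, star_Xb]
-- Since `δ_j N̄ = 0`, the commutator of `δ_j` and `∂/∂η^k` on `N̄` is a first order equation for `F
-- m_k X_h m̄^i`.
lemma delta_X (j h : Fin 2) : S.delta j (S.X h) = S.tr j * S.X h := by
  -- Multiplied by `F`, the tensor `F m_k m̄^i` involves only `η` and `∂L/∂η̄`, whose
  -- `δ_j`-derivatives are known. The prefactor is contracted to `L²` at the end.
  have key : ∀ i k, S.Db i * S.eta k * (S.delta j (S.X h) - S.tr j * S.X h) = 0 := by
    have fe : S.F * S.Finv * (S.F * S.Finv) * (S.s * S.sinv) = 1 := by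
      rw [S.F_mul_Finv, S.s_mul_sinv, one_mul, one_mul]
    have dF : S.delta j S.F = 0 := by
      rw [← S.star_F, ← star_deltab, deltab_F, star_zero]
    have frame : ∀ i k, S.F * (S.F * S.mD k * S.X h * S.mUb i)
        = ![- S.eta 1, S.eta 0] k * ![- S.Db 1, S.Db 0] i * S.X h := by
      refine Fin.forall_fin_two.2 ⟨Fin.forall_fin_two.2 ⟨?_, ?_⟩, Fin.forall_fin_two.2 ⟨?_, ?_⟩⟩
      · simp [mUb_zero, mD_zero]; linear_combination S.Db 1 * S.eta 1 * S.X h * fe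
      · simp [mUb_zero, mD_one]; linear_combination S.Db 1 * S.eta 0 * S.X h * fe
      · simp [mUb_one, mD_zero]; linear_combination S.Db 0 * S.eta 1 * S.X h * fe
      · simp [mUb_one, mD_one]; linear_combination S.Db 0 * S.eta 0 * S.X h * fe
    have eqn : ∀ i k, S.delta j (![- S.eta 1, S.eta 0] k * ![- S.Db 1, S.Db 0] i * S.X h)
        = S.G 0 k j * (- S.eta 1 * ![- S.Db 1, S.Db 0] i * S.X h)
          + S.G 1 k j * (S.eta 0 * ![- S.Db 1, S.Db 0] i * S.X h) := fun i k => by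
      have e := S.delta_de j k (S.Nb i h)
      rw [H.delta_Nb, map_zero, de_Nb, de_Nb, de_Nb] at e
      have f0 := frame i 0
      have f1 := frame i 1
      simp only [Matrix.cons_val_zero, Matrix.cons_val_one] at f0 f1
      rw [← frame, Derivation.leibniz, dF, e, ← f0, ← f1]
      simp only [smul_eq_mul]; ring
    have n0 := S.G_eta 0 j
    have n1 := S.G_eta 1 j
    refine Fin.forall_fin_two.2 ⟨Fin.forall_fin_two.2 ⟨?_, ?_⟩, Fin.forall_fin_two.2 ⟨?_, ?_⟩⟩
    · have e := eqn 1 1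
      simp [Derivation.leibniz, delta_Db, delta_eta] at e
      rw [tr]; linear_combination e - S.X h * S.Db 0 * n0
    · have e := eqn 1 0
      simp [Derivation.leibniz, delta_Db, delta_eta] at e
      rw [tr]; linear_combination -e - S.X h * S.Db 0 * n1
    · have e := eqn 0 1
      simp [Derivation.leibniz, delta_Db, delta_eta] at e
      rw [tr]; linear_combination -e - S.X h * S.Db 1 * n0
    · have e := eqn 0 0
      simp [Derivation.leibniz, delta_Db, delta_eta] at e
      rw [tr]; linear_combination e - S.X h * S.Db 1 * n1
  apply S.L_cancel
  apply S.L_cancel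
  have d := S.eta_D
  have d' := S.eb_Db
  linear_combination S.eb 0 * (S.D 0 * key 0 0 + S.D 1 * key 0 1)
    + S.eb 1 * (S.D 0 * key 1 0 + S.D 1 * key 1 1)
    - (S.delta j (S.X h) - S.tr j * S.X h)
      * ((S.eb 0 * S.Db 0 + S.eb 1 * S.Db 1) * d + S.L * d')
-- The trace from `δ_j X` is halved by the factor `1/√g` in `m̄`.
lemma two_delta_Om (j : Fin 2) : 2 * S.delta j S.Om = S.tr j * S.Om := by
  have hF : S.delta j S.Finv = 0 := by
    rw [← S.star_Finv, ← star_deltab, deltab_Finv, star_zero]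
  have hs := congrArg star (S.two_deltab_sinv j)
  rw [star_mul', star_mul', star_ofNat, star_deltab, star_neg, star_trb, star_sinv] at hs
  rw [Om, mUb_zero, mUb_one]
  simp only [Derivation.leibniz, map_add, map_neg, smul_eq_mul, H.delta_X, delta_Db, hF]
  linear_combination (S.X 1 * S.Db 0 - S.X 0 * S.Db 1) * S.Finv * hs
/-- If `L |Ω|²` is an invertible constant, then `Ω` vanishes. -/
lemma Om_eq_zero (c d : R) (hc : ∀ j, S.delta j c = 0) (hcd : c * d = 1)
    (h : S.L * S.Om * S.Omb = c) : S.Om = 0 := by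
  have a := H.two_delta_Om
  have b : ∀ j, 2 * S.deltab j S.Omb = S.trb j * S.Omb := fun j => by
    have := congrArg star (a j)
    rwa [star_mul', star_mul', star_ofNat, star_delta, star_tr] at this
  have e : ∀ j, S.tr j * S.Omb + 2 * S.delta j S.Omb = 0 := fun j => by
    -- `L` and `c` are horizontally constant and `Ω` is invertible because `c` is, so `δ_j Ω̄` can
    -- be solved for.
    have h1 := congrArg (S.delta j) h
    rw [hc, Derivation.leibniz, Derivation.leibniz, delta_L] at h1
    simp only [smul_eq_mul] at h1
    have h2 : S.Om * (S.tr j * S.Omb + 2 * S.delta j S.Omb) = 0 := by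
      apply S.L_cancel
      linear_combination 2 * h1 - S.L * S.Omb * a j
    linear_combination S.L * S.Omb * d * h2
      - (S.tr j * S.Omb + 2 * S.delta j S.Omb) * (d * h + hcd)
  -- Now `2 δ_j Ω̄ = -tr_j Ω̄` and `2 δ_h̄ Ω̄ = trb_h Ω̄`. The opposite signs make the derivatives
  -- of the two traces add up, instead of cancelling, when the mixed derivatives are equated.
  have f : ∀ j h, S.Omb * S.Xb j * S.X h = 0 := fun j h => by
    have h1 := congrArg (S.deltab h) (e j)
    have h2 := congrArg (S.delta j) (b h)
    simp only [two_mul, map_add, Derivation.leibniz, smul_eq_mul, H.deltab_tr, H.delta_trb,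
      H.delta_comm, map_zero] at h1 h2
    apply S.two_cancel
    apply S.two_cancel
    apply S.L_cancel
    linear_combination 2 * h1 - 2 * h2 - S.tr j * b h - S.trb h * e j
  have e' : S.Xb 0 * S.mU 0 + S.Xb 1 * S.mU 1 = S.Omb := by
    simp only [Omb, Om, star_add, star_mul', star_X, star_mUb]
  have z : S.Omb * S.Omb * S.Om = 0 := by
    rw [Om]
    linear_combination S.mUb 0 * (S.mU 0 * f 0 0 + S.mU 1 * f 1 0)
      + S.mUb 1 * (S.mU 0 * f 0 1 + S.mU 1 * f 1 1)
      - S.Omb * (S.X 0 * S.mUb 0 + S.X 1 * S.mUb 1) * e'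
  have z' : S.Omb = 0 := by
    linear_combination S.L * d * z - S.Omb * (d * h + hcd)
  rw [← star_Omb, z', star_zero]

end IsSpecial

end FinslerRing

noncomputable section

open TopologicalSpace (Opens)

/-! ### The ring of smooth functions on an open set -/

open Classical in
/-- Extension by zero of a function on `U`. -/
def extZero (U : Opens (C2 × C2)) (f : U → ℂ) (p : C2 × C2) : ℂ :=
  if h : p ∈ U then f ⟨p, h⟩ else 0

lemma extZero_coe {U : Opens (C2 × C2)} (f : U → ℂ) (p : U) : extZero U f p = f p := by
  simp [extZero]

lemma extZero_of_mem {U : Opens (C2 × C2)} (f : U → ℂ) {p : C2 × C2} (hp : p ∈ U) :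
    extZero U f p = f ⟨p, hp⟩ := extZero_coe f ⟨p, hp⟩

/-- The ring of smooth complex valued functions on `U`. -/
def smoothRing (U : Opens (C2 × C2)) : Subring (U → ℂ) where
  carrier := {f | ContDiffOn ℝ ∞ (extZero U f) U}
  mul_mem' {f g} hf hg := (ContDiffOn.mul hf hg).congr fun p hp => by
    simp [extZero_of_mem _ hp]
  add_mem' {f g} hf hg := (ContDiffOn.add hf hg).congr fun p hp => by
    simp [extZero_of_mem _ hp]
  neg_mem' {f} hf := (ContDiffOn.neg hf).congr fun p hp => by
    simp [extZero_of_mem _ hp]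
  one_mem' := (contDiffOn_const (c := (1 : ℂ))).congr fun p hp => by
    simp [extZero_of_mem _ hp]
  zero_mem' := (contDiffOn_const (c := (0 : ℂ))).congr fun p hp => by
    simp [extZero_of_mem _ hp]

variable {U : Opens (C2 × C2)}

lemma mem_smoothRing {h : C2 × C2 → ℂ} (hs : ContDiffOn ℝ ∞ h U) :
    (fun p : U => h p) ∈ smoothRing U :=
  hs.congr fun _ hp => extZero_of_mem _ hp

/-- The restriction of a smooth function to `U`. -/
def toSmooth (h : C2 × C2 → ℂ) (hs : ContDiffOn ℝ ∞ h U) : smoothRing U :=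
  ⟨fun p => h p, mem_smoothRing hs⟩

/-- `h` restricts to `r` on `U`. -/
def RestrictsTo (h : C2 × C2 → ℂ) (r : smoothRing U) : Prop := ∀ p : U, h p = r.1 p

lemma restrictsTo_toSmooth (h : C2 × C2 → ℂ) (hs : ContDiffOn ℝ ∞ h U) : RestrictsTo h (toSmooth h hs) :=
  fun _ => rfl

lemma restrictsTo_extZero (r : smoothRing U) : RestrictsTo (extZero U r.1) r := fun p => extZero_coe _ p

lemma RestrictsTo.eqOn {h h' : C2 × C2 → ℂ} {r : smoothRing U} (H : RestrictsTo h r) (H' : RestrictsTo h' r) :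
    Set.EqOn h h' U := fun p hp => (H ⟨p, hp⟩).trans (H' ⟨p, hp⟩).symm

lemma RestrictsTo.contDiffOn {h : C2 × C2 → ℂ} {r : smoothRing U} (H : RestrictsTo h r) :
    ContDiffOn ℝ ∞ h U := r.2.congr (H.eqOn (restrictsTo_extZero r))

lemma RestrictsTo.add {h h' : C2 × C2 → ℂ} {r r' : smoothRing U} (H : RestrictsTo h r) (H' : RestrictsTo h' r') :
    RestrictsTo (fun p => h p + h' p) (r + r') := fun p => congrArg₂ (· + ·) (H p) (H' p)
lemma RestrictsTo.mul {h h' : C2 × C2 → ℂ} {r r' : smoothRing U} (H : RestrictsTo h r) (H' : RestrictsTo h' r') :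
    RestrictsTo (fun p => h p * h' p) (r * r') := fun p => congrArg₂ (· * ·) (H p) (H' p)
lemma RestrictsTo.sub {h h' : C2 × C2 → ℂ} {r r' : smoothRing U} (H : RestrictsTo h r) (H' : RestrictsTo h' r') :
    RestrictsTo (fun p => h p - h' p) (r - r') := fun p => congrArg₂ (· - ·) (H p) (H' p)
lemma RestrictsTo.neg {h : C2 × C2 → ℂ} {r : smoothRing U} (H : RestrictsTo h r) :
    RestrictsTo (fun p => - h p) (-r) := fun p => congrArg (- ·) (H p)
lemma RestrictsTo.sum {h : Fin 2 → C2 × C2 → ℂ} {r : Fin 2 → smoothRing U} (H : ∀ i, RestrictsTo (h i) (r i)) :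
    RestrictsTo (fun p => ∑ i, h i p) (∑ i, r i) := by
  simp only [Fin.sum_univ_two]
  exact (H 0).add (H 1)

lemma RestrictsTo.unique {h : C2 × C2 → ℂ} {r r' : smoothRing U} (H : RestrictsTo h r) (H' : RestrictsTo h r') :
    r = r' := Subtype.ext (funext fun p => (H p).symm.trans (H' p))

instance : StarRing (smoothRing U) where
  star f := ⟨fun p => star (f.1 p),
    (Complex.conjCLE.contDiff.comp_contDiffOn f.2).congr fun p hp => by
      simp [extZero_of_mem _ hp]⟩
  star_involutive f := Subtype.ext (funext fun p => star_star _)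
  star_mul f g := Subtype.ext (funext fun p => star_mul _ _)
  star_add f g := Subtype.ext (funext fun p => star_add _ _)

lemma RestrictsTo.star {h : C2 × C2 → ℂ} {r : smoothRing U} (H : RestrictsTo h r) :
    RestrictsTo (fun p => star (h p)) (star r) := fun p => congrArg Star.star (H p)

/-! ### Wirtinger derivations -/

/-- The common form of the two Wirtinger derivatives along `v`. -/
def gwirt (a : ℂ) (v : C2 × C2) (f : C2 × C2 → ℂ) (p : C2 × C2) : ℂ :=
  (1 / 2 : ℂ) * (fderiv ℝ f p v + a * fderiv ℝ f p (Complex.I • v))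

lemma wirt_eq (v : C2 × C2) : wirt v = gwirt (-Complex.I) v := by
  ext f p; simp only [wirt, gwirt]; ring

lemma ContDiffOn.gwirt {f : C2 × C2 → ℂ} (hf : ContDiffOn ℝ ∞ f U) (a : ℂ) (v : C2 × C2) :
    ContDiffOn ℝ ∞ (gwirt a v f) U := by
  have h := hf.fderiv_of_isOpen (m := ∞) U.isOpen (by simp)
  exact contDiffOn_const.mul ((h.clm_apply contDiffOn_const).add
    (contDiffOn_const.mul (h.clm_apply contDiffOn_const)))

lemma gwirt_congr {f g : C2 × C2 → ℂ} (h : Set.EqOn f g U) (a : ℂ) (v : C2 × C2) :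
    Set.EqOn (gwirt a v f) (gwirt a v g) U := fun p hp => by
  have : f =ᶠ[nhds p] g := Filter.eventuallyEq_of_mem (U.isOpen.mem_nhds hp) h
  simp only [gwirt, this.fderiv_eq]

lemma ContDiffOn.differentiableAt_of_mem {f : C2 × C2 → ℂ} (hf : ContDiffOn ℝ ∞ f U)
    {p : C2 × C2} (hp : p ∈ U) : DifferentiableAt ℝ f p :=
  (hf.contDiffAt (U.isOpen.mem_nhds hp)).differentiableAt (by simp)

/-- The Wirtinger derivations of the ring of smooth functions. -/
def wirtDer (a : ℂ) (v : C2 × C2) : Derivation ℤ (smoothRing U) (smoothRing U) :=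
  Derivation.mk' (AddMonoidHom.toIntLinearMap
    { toFun := fun f => toSmooth (gwirt a v (extZero U f.1)) (ContDiffOn.gwirt f.2 a v)
      map_zero' := by
        have : Set.EqOn (extZero U (0 : U → ℂ)) (fun _ => 0) U := fun p hp => by
          simp [extZero_of_mem _ hp]
        refine Subtype.ext (funext fun p => ?_)
        change gwirt a v (extZero U (0 : U → ℂ)) p = 0
        rw [gwirt_congr this a v p.2]
        simp [gwirt]
      map_add' := fun f g => by
        have : Set.EqOn (extZero U (f.1 + g.1)) (extZero U f.1 + extZero U g.1) U :=
          fun p hp => by simp [extZero_of_mem _ hp]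
        refine Subtype.ext (funext fun p => ?_)
        change gwirt a v (extZero U (f.1 + g.1)) p
          = gwirt a v (extZero U f.1) p + gwirt a v (extZero U g.1) p
        rw [gwirt_congr this a v p.2]
        simp only [gwirt, fderiv_add (ContDiffOn.differentiableAt_of_mem f.2 p.2)
          (ContDiffOn.differentiableAt_of_mem g.2 p.2), add_apply]
        ring })
  (fun f g => by
    have : Set.EqOn (extZero U (f.1 * g.1)) (extZero U f.1 * extZero U g.1) U :=
      fun p hp => by simp [extZero_of_mem _ hp]
    refine Subtype.ext (funext fun p => ?_)
    change gwirt a v (extZero U (f.1 * g.1)) p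
      = f.1 p * gwirt a v (extZero U g.1) p + g.1 p * gwirt a v (extZero U f.1) p
    rw [gwirt_congr this a v p.2, ← extZero_coe f.1, ← extZero_coe g.1]
    simp only [gwirt, fderiv_mul (ContDiffOn.differentiableAt_of_mem f.2 p.2)
      (ContDiffOn.differentiableAt_of_mem g.2 p.2), add_apply,
      smul_apply, smul_eq_mul]
    ring)

lemma RestrictsTo.gwirt {h : C2 × C2 → ℂ} {r : smoothRing U} (H : RestrictsTo h r) (a : ℂ) (v : C2 × C2) :
    RestrictsTo (gwirt a v h) (wirtDer a v r) := fun p =>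
  gwirt_congr (H.eqOn (restrictsTo_extZero r)) a v p.2

lemma star_wirtDer (a : ℂ) (v : C2 × C2) (f : smoothRing U) :
    star (wirtDer a v f) = wirtDer (star a) v (star f) := by
  refine ((restrictsTo_extZero f).gwirt a v).star.unique ?_
  refine fun p => Eq.trans ?_ ((restrictsTo_extZero f).star.gwirt (star a) v p)
  have h := Complex.conjCLE.toContinuousLinearMap.hasFDerivAt.comp (p : C2 × C2)
    (ContDiffOn.differentiableAt_of_mem f.2 p.2).hasFDerivAt
  have h' : fderiv ℝ (fun q => star (extZero U f.1 q)) (p : C2 × C2) = _ := h.fderiv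
  simp only [_root_.gwirt, h']
  simp

lemma fderiv_gwirt {f : C2 × C2 → ℂ} (hf : ContDiffOn ℝ ∞ f U) {p : C2 × C2} (hp : p ∈ U)
    (a : ℂ) (v w : C2 × C2) : fderiv ℝ (gwirt a v f) p w
      = (1 / 2 : ℂ) * (fderiv ℝ (fderiv ℝ f) p w v
        + a * fderiv ℝ (fderiv ℝ f) p w (Complex.I • v)) := by
  have h := (hf.fderiv_of_isOpen (m := ∞) U.isOpen (by simp)).contDiffAt (U.isOpen.mem_nhds hp)
  have hd := (h.differentiableAt (by simp)).hasFDerivAt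
  have h1 := hd.clm_apply (hasFDerivAt_const v p)
  have h2 := hd.clm_apply (hasFDerivAt_const (Complex.I • v) p)
  have h3 : HasFDerivAt (gwirt a v f) _ p := (h1.add (h2.const_mul a)).const_mul (1 / 2 : ℂ)
  rw [h3.fderiv]
  simp
  ring

lemma wirtDer_comm (a b : ℂ) (v w : C2 × C2) (f : smoothRing U) :
    wirtDer a v (wirtDer b w f) = wirtDer b w (wirtDer a v f) := by
  refine (((restrictsTo_extZero f).gwirt b w).gwirt a v).unique ?_
  refine fun p => Eq.trans ?_ (((restrictsTo_extZero f).gwirt a v).gwirt b w p)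
  have hs : IsSymmSndFDerivAt ℝ (extZero U f.1) (p : C2 × C2) :=
    (ContDiffOn.contDiffAt f.2 (U.isOpen.mem_nhds p.2)).isSymmSndFDerivAt (by
      simpa using WithTop.coe_le_coe.2 (le_top : (2 : ℕ∞) ≤ ⊤))
  rw [gwirt, gwirt, fderiv_gwirt f.2 p.2, fderiv_gwirt f.2 p.2, fderiv_gwirt f.2 p.2,
    fderiv_gwirt f.2 p.2, hs.eq v w, hs.eq v (Complex.I • w), hs.eq (Complex.I • v) w,
    hs.eq (Complex.I • v) (Complex.I • w)]
  ring

/-! ### The ring of smooth functions on the domain of a metric -/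

/-- A complex Finsler metric on an open set of coordinates. -/
structure IsLocalMetric (U : Opens (C2 × C2)) (F : C2 × C2 → ℝ) : Prop where
  pos : ∀ p ∈ U, 0 < F p
  smooth : ContDiffOn ℝ ∞ (fun p => F p ^ 2) U
  smul_mem : ∀ p ∈ U, ∀ c : ℂ, c ≠ 0 → (p.1, c • p.2) ∈ U
  homogeneous : ∀ p ∈ U, ∀ c : ℂ, c ≠ 0 → F (p.1, c • p.2) = ‖c‖ * F p
  posDef : ∀ p ∈ U, (LocalFinsler.gMat F p).PosDef

open LocalFinsler

variable {F : C2 × C2 → ℝ}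

lemma contDiffOn_ofReal {f : C2 × C2 → ℝ} (hf : ContDiffOn ℝ ∞ f U) :
    ContDiffOn ℝ ∞ (fun p => (f p : ℂ)) U :=
  Complex.ofRealCLM.contDiff.comp_contDiffOn hf

/-- The fibre coordinate `η^i`. -/
def etaFn (i : Fin 2) : (C2 × C2) →L[ℂ] ℂ :=
  (ContinuousLinearMap.proj (R := ℂ) (φ := fun _ : Fin 2 => ℂ) i).comp
    (ContinuousLinearMap.snd ℂ C2 C2)

lemma etaFn_apply (i : Fin 2) (p : C2 × C2) : etaFn i p = p.2 i := rfl

lemma contDiffOn_etaFn (i : Fin 2) : ContDiffOn ℝ ∞ (fun p : C2 × C2 => p.2 i) U :=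
  ((etaFn i).restrictScalars ℝ).contDiff.contDiffOn

lemma gwirt_etaFn (a : ℂ) (v : C2 × C2) (i : Fin 2) (p : C2 × C2) :
    gwirt a v (fun p => p.2 i) p = (1 / 2 : ℂ) * (1 + a * Complex.I) * v.2 i := by
  have h : fderiv ℝ (fun p : C2 × C2 => p.2 i) p = (etaFn i).restrictScalars ℝ :=
    ((etaFn i).restrictScalars ℝ).hasFDerivAt.fderiv
  rw [gwirt, h]
  simp [etaFn_apply]; ring

/-- The choice `a = -i` makes the Wirtinger derivative complex linear in the direction, as needed
for the complex Euler identity. -/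
lemma gwirt_smul (c : ℂ) (v : C2 × C2) (f : C2 × C2 → ℂ) (p : C2 × C2) :
    gwirt (-Complex.I) (c • v) f p = c * gwirt (-Complex.I) v f p := by
  have h1 : c • v = c.re • v + c.im • (Complex.I • v) := by
    rw [← Complex.coe_smul, ← Complex.coe_smul, smul_smul, ← add_smul, Complex.re_add_im]
  have h2 : Complex.I • c • v = c.re • (Complex.I • v) - c.im • v := by
    rw [h1, smul_add, smul_comm, smul_comm Complex.I c.im, smul_smul Complex.I Complex.I,
      Complex.I_mul_I]
    simp [sub_eq_add_neg]
  simp only [gwirt]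
  rw [h2, h1]
  simp only [map_add, map_sub, map_smul, Complex.real_smul]
  conv_rhs => rw [← Complex.re_add_im c]
  linear_combination ((1 / 2 : ℂ) * c.im * fderiv ℝ f p (Complex.I • v)) * Complex.I_mul_I

lemma gwirt_add (a : ℂ) (v w : C2 × C2) (f : C2 × C2 → ℂ) (p : C2 × C2) :
    gwirt a (v + w) f p = gwirt a v f p + gwirt a w f p := by
  simp only [gwirt, smul_add, map_add]; ring

namespace IsLocalMetric

variable (hF : IsLocalMetric U F)
include hF

lemma contDiffOn_sq : ContDiffOn ℝ ∞ (sq F) U := contDiffOn_ofReal hF.smooth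

lemma contDiffOn_F : ContDiffOn ℝ ∞ F U :=
  (hF.smooth.sqrt fun p hp => (pow_pos (hF.pos p hp) 2).ne').congr fun p hp =>
    (Real.sqrt_sq (hF.pos p hp).le).symm

/-- Differentiate `L(z, (1 + tc)η) = |1 + tc|² L(z, η)` at `t = 0`; near `0` the factor `1 + tc` is
nonzero, so homogeneity applies. -/
lemma fderiv_sq {p : C2 × C2} (hp : p ∈ U) (c : ℂ) :
    fderiv ℝ (sq F) p (0, c • p.2) = 2 * c.re * sq F p := by
  have h1 : HasDerivAt (fun t : ℝ => p + t • ((0, c • p.2) : C2 × C2)) (0, c • p.2) 0 := by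
    simpa using ((hasDerivAt_id (0 : ℝ)).smul_const ((0, c • p.2) : C2 × C2)).const_add p
  have h2 : HasFDerivAt (sq F) (fderiv ℝ (sq F) p) (p + (0 : ℝ) • ((0, c • p.2) : C2 × C2)) := by
    simpa using (hF.contDiffOn_sq.differentiableAt_of_mem hp).hasFDerivAt
  have h3 := h2.comp_hasDerivAt (0 : ℝ) h1
  have h4 : HasDerivAt (fun t : ℝ => (((1 + t * c.re) ^ 2 + (t * c.im) ^ 2 : ℝ) : ℂ) * sq F p)
      (2 * c.re * sq F p) 0 := by
    have h5 : HasDerivAt (fun t : ℝ => (1 + t * c.re) ^ 2 + (t * c.im) ^ 2) (2 * c.re) 0 := by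
      have ha := (((hasDerivAt_id (0 : ℝ)).mul_const c.re).const_add 1).pow 2
      have hb := ((hasDerivAt_id (0 : ℝ)).mul_const c.im).pow 2
      exact (ha.add hb).congr_deriv (by simp)
    have := h5.ofReal_comp.mul_const (sq F p)
    simpa using this
  have h6 : ∀ᶠ t : ℝ in nhds 0, (1 : ℂ) + t * c ≠ 0 := by
    have : ContinuousAt (fun t : ℝ => (1 : ℂ) + t * c) 0 := by fun_prop
    exact this.eventually_ne (by simp)
  refine h3.unique (h4.congr_of_eventuallyEq ?_)
  filter_upwards [h6] with t ht
  have e : p + t • ((0, c • p.2) : C2 × C2) = (p.1, ((1 : ℂ) + t * c) • p.2) := by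
    ext i
    · simp
    · simp; ring
  have n : ‖(1 : ℂ) + t * c‖ ^ 2 = (1 + t * c.re) ^ 2 + (t * c.im) ^ 2 := by
    rw [← Complex.normSq_eq_norm_sq, Complex.normSq_apply]
    simp; ring
  simp only [Function.comp_apply, LocalFinsler.sq]
  rw [e, hF.homogeneous p hp _ ht, mul_pow, n]
  push_cast; ring

lemma euler {p : C2 × C2} (hp : p ∈ U) :
    p.2 0 * dEta 0 (sq F) p + p.2 1 * dEta 1 (sq F) p = sq F p := by
  simp only [dEta, wirt_eq]
  rw [← gwirt_smul, ← gwirt_smul, ← gwirt_add]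
  have e : p.2 0 • ((0, Pi.single 0 1) : C2 × C2) + p.2 1 • ((0, Pi.single 1 1) : C2 × C2)
      = (0, (1 : ℂ) • p.2) := by
    ext i
    · simp
    · fin_cases i <;> simp
  have e' : Complex.I • ((0, (1 : ℂ) • p.2) : C2 × C2) = (0, Complex.I • p.2) := by simp
  rw [e, gwirt, e', hF.fderiv_sq hp, hF.fderiv_sq hp]
  simp

lemma det_pos {p : C2 × C2} (hp : p ∈ U) : 0 < (gMat F p).det := (hF.posDef p hp).det_pos

end IsLocalMetric

namespace RestrictsTo

variable {h : C2 × C2 → ℂ} {r : smoothRing U} (H : RestrictsTo h r)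
include H

lemma dEta (i : Fin 2) :
    RestrictsTo (dEta i h) (wirtDer (-Complex.I) (0, Pi.single i 1) r) := by
  rw [_root_.dEta, wirt_eq]; exact H.gwirt _ _
lemma dEtaBar (i : Fin 2) :
    RestrictsTo (dEtaBar i h) (wirtDer Complex.I (0, Pi.single i 1) r) := H.gwirt _ _
lemma dZ (i : Fin 2) :
    RestrictsTo (dZ i h) (wirtDer (-Complex.I) (Pi.single i 1, 0) r) := by
  rw [_root_.dZ, wirt_eq]; exact H.gwirt _ _
lemma dZbar (i : Fin 2) :
    RestrictsTo (dZbar i h) (wirtDer Complex.I (Pi.single i 1, 0) r) := H.gwirt _ _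

end RestrictsTo

lemma wirtDer_eta (a : ℂ) (v : C2 × C2) (i : Fin 2) (p : U) :
    (wirtDer a v (toSmooth (U := U) (fun p => p.2 i) (contDiffOn_etaFn i))).1 p
      = (1 / 2 : ℂ) * (1 + a * Complex.I) * v.2 i := by
  rw [← gwirt_etaFn a v i p]
  exact ((restrictsTo_toSmooth _ _).gwirt a v p).symm

namespace IsLocalMetric

variable (hF : IsLocalMetric U F)
include hF

lemma restrictsTo_sq : RestrictsTo (sq F) (toSmooth (sq F) hF.contDiffOn_sq) :=
  restrictsTo_toSmooth _ _

lemma contDiffOn_det : ContDiffOn ℝ ∞ (fun p => (gMat F p).det) U := by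
  have h : ∀ i j, ContDiffOn ℝ ∞ (g F i j) U := fun i j =>
    ((hF.restrictsTo_sq.dEtaBar j).dEta i).contDiffOn
  simp only [Matrix.det_fin_two, gMat, Matrix.of_apply]
  exact ((h 0 0).mul (h 1 1)).sub ((h 0 1).mul (h 1 0))

lemma det_re_pos {p : C2 × C2} (hp : p ∈ U) : 0 < (gMat F p).det.re :=
  (Complex.pos_iff.1 (hF.det_pos hp)).1

lemma sqrtDet_mul_self {p : C2 × C2} (hp : p ∈ U) :
    sqrtDet F p * sqrtDet F p = (gMat F p).det := by
  rw [sqrtDet, ← Complex.ofReal_mul, Real.mul_self_sqrt (hF.det_re_pos hp).le]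
  exact Complex.ext rfl (Complex.pos_iff.1 (hF.det_pos hp)).2

lemma sqrtDet_ne_zero {p : C2 × C2} (hp : p ∈ U) : sqrtDet F p ≠ 0 :=
  Complex.ofReal_ne_zero.2 (Real.sqrt_pos.2 (hF.det_re_pos hp)).ne'

lemma contDiffOn_sqrtDet : ContDiffOn ℝ ∞ (sqrtDet F) U :=
  contDiffOn_ofReal ((Complex.reCLM.contDiff.comp_contDiffOn hF.contDiffOn_det).sqrt
    fun _ hp => (hF.det_re_pos hp).ne')

lemma F_ne_zero {p : C2 × C2} (hp : p ∈ U) : (F p : ℂ) ≠ 0 :=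
  Complex.ofReal_ne_zero.2 (hF.pos p hp).ne'

omit hF in
lemma contDiffOn_inv {f : C2 × C2 → ℂ} (hf : ContDiffOn ℝ ∞ f U) (h : ∀ p ∈ U, f p ≠ 0) :
    ContDiffOn ℝ ∞ (fun p => (f p)⁻¹) U := hf.inv h

/-- The ring of smooth functions on the domain of a metric. -/
def ring : FinslerRing (smoothRing U) where
  dz k := wirtDer (-Complex.I) (Pi.single k 1, 0)
  dzb k := wirtDer Complex.I (Pi.single k 1, 0)
  de k := wirtDer (-Complex.I) (0, Pi.single k 1)
  deb k := wirtDer Complex.I (0, Pi.single k 1)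
  star_dz k f := by rw [star_wirtDer]; simp
  star_de k f := by rw [star_wirtDer]; simp
  de_de i j f := wirtDer_comm _ _ _ _ f
  de_deb i j f := wirtDer_comm _ _ _ _ f
  dz_de i j f := wirtDer_comm _ _ _ _ f
  dz_deb i j f := wirtDer_comm _ _ _ _ f
  dz_dzb i j f := wirtDer_comm _ _ _ _ f
  eta i := toSmooth (fun p => p.2 i) (contDiffOn_etaFn i)
  de_eta i j := by
    refine Subtype.ext (funext fun p => ?_)
    rw [wirtDer_eta]
    revert i j
    refine Fin.forall_fin_two.2 ⟨Fin.forall_fin_two.2 ⟨?_, ?_⟩, Fin.forall_fin_two.2 ⟨?_, ?_⟩⟩ <;>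
    · simp <;> norm_num
  deb_eta i j := by
    refine Subtype.ext (funext fun p => ?_)
    rw [wirtDer_eta]
    simp
  dz_eta i j := by
    refine Subtype.ext (funext fun p => ?_)
    rw [wirtDer_eta]
    simp
  dzb_eta i j := by
    refine Subtype.ext (funext fun p => ?_)
    rw [wirtDer_eta]
    simp
  L := toSmooth (sq F) hF.contDiffOn_sq
  star_L := Subtype.ext (funext fun p => Complex.conj_ofReal _)
  euler := by
    refine Subtype.ext (funext fun p => Eq.trans ?_ (hF.euler p.2))
    rw [hF.restrictsTo_sq.dEta 0 p, hF.restrictsTo_sq.dEta 1 p]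
    rfl
  F := toSmooth (fun p => (F p : ℂ)) (contDiffOn_ofReal hF.contDiffOn_F)
  Finv := toSmooth (fun p => (F p : ℂ)⁻¹)
    (contDiffOn_inv (contDiffOn_ofReal hF.contDiffOn_F) fun _ => hF.F_ne_zero)
  star_F := Subtype.ext (funext fun p => Complex.conj_ofReal _)
  F_mul_F := Subtype.ext (funext fun p => by
    change (F p : ℂ) * F p = ((F p ^ 2 : ℝ) : ℂ)
    push_cast; ring)
  F_mul_Finv := Subtype.ext (funext fun p => mul_inv_cancel₀ (hF.F_ne_zero p.2))
  s := toSmooth (sqrtDet F) hF.contDiffOn_sqrtDet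
  sinv := toSmooth (fun p => (sqrtDet F p)⁻¹)
    (contDiffOn_inv hF.contDiffOn_sqrtDet fun _ => hF.sqrtDet_ne_zero)
  star_s := Subtype.ext (funext fun p => Complex.conj_ofReal _)
  s_mul_s := by
    refine Subtype.ext (funext fun p => ?_)
    have h : ∀ i j, _ := fun i j => (hF.restrictsTo_sq.dEtaBar j).dEta i p
    refine (hF.sqrtDet_mul_self p.2).trans ?_
    rw [Matrix.det_fin_two]
    change g F 0 0 p * g F 1 1 p - g F 0 1 p * g F 1 0 p = _
    simp only [g, h]
    rfl
  s_mul_sinv := Subtype.ext (funext fun p => mul_inv_cancel₀ (hF.sqrtDet_ne_zero p.2))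
  two_cancel x h := by
    refine Subtype.ext (funext fun p => ?_)
    have := congrFun (congrArg Subtype.val h) p
    change (2 : ℂ) * x.1 p = 0 at this
    simpa using this

/-! ### Matching chart expressions with ring elements. -/

lemma res_g (i j : Fin 2) : RestrictsTo (g F i j) (hF.ring.g i j) :=
  (hF.restrictsTo_sq.dEtaBar j).dEta i
lemma res_eta (i : Fin 2) : RestrictsTo (fun p => p.2 i) (hF.ring.eta i) :=
  restrictsTo_toSmooth _ (contDiffOn_etaFn i)
lemma res_F : RestrictsTo (fun p => (F p : ℂ)) hF.ring.F :=
  restrictsTo_toSmooth _ (contDiffOn_ofReal hF.contDiffOn_F)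
lemma res_gInv (m k : Fin 2) : RestrictsTo (gInv F m k) (hF.ring.gi m k) := by
  intro p
  have hd := hF.sqrtDet_mul_self p.2
  have e : gInv F m k p = (sqrtDet F p)⁻¹ * (sqrtDet F p)⁻¹ * (gMat F p).adjugate m k := by
    rw [gInv, Matrix.inv_def, Ring.inverse_eq_inv', ← hd, mul_inv]; rfl
  have h := fun i j => hF.res_g i j p
  rw [e, Matrix.adjugate_fin_two]
  change _ = (sqrtDet F p)⁻¹ * (sqrtDet F p)⁻¹ * (_ : smoothRing U).1 p
  congr 1
  revert m k
  refine Fin.forall_fin_two.2 ⟨Fin.forall_fin_two.2 ⟨?_, ?_⟩, Fin.forall_fin_two.2 ⟨?_, ?_⟩⟩ <;>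
  · intro _; simp [gMat, h]
lemma res_nlc (k j : Fin 2) : RestrictsTo (nlc F k j) (hF.ring.N k j) :=
  RestrictsTo.sum fun m => RestrictsTo.sum fun l =>
    ((hF.res_gInv m k).mul ((hF.res_g l m).dZ j)).mul (hF.res_eta l)
lemma res_delta {f : C2 × C2 → ℂ} {r : smoothRing U} (h : RestrictsTo f r) (k : Fin 2) :
    RestrictsTo (delta F k f) (hF.ring.delta k r) := by
  intro p
  rw [FinslerRing.delta_apply, delta, Fin.sum_univ_two]
  exact (h.dZ k).sub (((hF.res_nlc 0 k).mul (h.dEta 0)).add ((hF.res_nlc 1 k).mul (h.dEta 1))) p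
lemma res_deltaBar {f : C2 × C2 → ℂ} {r : smoothRing U} (h : RestrictsTo f r) (k : Fin 2) :
    RestrictsTo (deltaBar F k f) (hF.ring.deltab k r) := by
  intro p
  rw [FinslerRing.deltab_apply, deltaBar, Fin.sum_univ_two]
  exact (h.dZbar k).sub (((hF.res_nlc 0 k).star.mul (h.dEtaBar 0)).add
    ((hF.res_nlc 1 k).star.mul (h.dEtaBar 1))) p
lemma res_connL (i j k : Fin 2) : RestrictsTo (connL F i j k) (hF.ring.G i j k) :=
  RestrictsTo.sum fun l => (hF.res_gInv l i).mul (hF.res_delta (hF.res_g j l) k)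
lemma res_connC (i j k : Fin 2) : RestrictsTo (connC F i j k) (hF.ring.C i j k) :=
  RestrictsTo.sum fun l => (hF.res_gInv l i).mul ((hF.res_g j l).dEta k)
lemma res_curv (i j h k : Fin 2) : RestrictsTo (curv F i j h k) (hF.ring.curv i j h k) :=
  (hF.res_deltaBar (hF.res_connL i j k) h).neg.sub
    (RestrictsTo.sum fun l => (hF.res_deltaBar (hF.res_nlc l k) h).mul (hF.res_connC i j l))
lemma res_curvLow (r j h k : Fin 2) : RestrictsTo (curvLow F r j h k) (hF.ring.Rm r j h k) :=
  RestrictsTo.sum fun i => (hF.res_g i r).mul (hF.res_curv i j h k)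
lemma res_lUp (i : Fin 2) : RestrictsTo (lUp F i) (hF.ring.lU i) := fun _ => div_eq_mul_inv _ _
lemma res_lDown (i : Fin 2) : RestrictsTo (lDown F i) (hF.ring.lD i) :=
  RestrictsTo.sum fun j => (hF.res_g i j).mul (hF.res_lUp j).star
lemma res_mUp (i : Fin 2) : RestrictsTo (mUp F i) (hF.ring.mU i) := by
  revert i
  refine Fin.forall_fin_two.2 ⟨fun p => ?_, fun p => ?_⟩
  · change - lDown F 1 p / sqrtDet F p = _
    rw [hF.res_lDown 1 p, div_eq_mul_inv]; rfl
  · change lDown F 0 p / sqrtDet F p = _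
    rw [hF.res_lDown 0 p, div_eq_mul_inv]; rfl
lemma res_mDown (i : Fin 2) : RestrictsTo (mDown F i) (hF.ring.mD i) :=
  RestrictsTo.sum fun j => (hF.res_g i j).mul (hF.res_mUp j).star
lemma res_coefA : RestrictsTo (coefA F) hF.ring.A :=
  RestrictsTo.sum fun h => RestrictsTo.sum fun j => RestrictsTo.sum fun k =>
    (((hF.res_mUp j).mul (hF.res_mUp k)).mul (hF.res_lDown h)).mul (hF.res_connC h k j)
lemma res_coefJ : RestrictsTo (coefJ F) hF.ring.cJ :=
  RestrictsTo.sum fun i => RestrictsTo.sum fun j => RestrictsTo.sum fun k =>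
    (((hF.res_lUp j).mul (hF.res_lUp k)).mul (hF.res_lDown i)).mul (hF.res_connL i j k)
lemma res_coefV : RestrictsTo (coefV F) hF.ring.cV :=
  RestrictsTo.sum fun i => RestrictsTo.sum fun j => RestrictsTo.sum fun k =>
    (((hF.res_lUp j).mul (hF.res_mUp k)).mul (hF.res_lDown i)).mul (hF.res_connL i j k)
lemma res_coefY : RestrictsTo (coefY F) hF.ring.cY :=
  RestrictsTo.sum fun i => RestrictsTo.sum fun j => RestrictsTo.sum fun k =>
    (((hF.res_mUp j).mul (hF.res_lUp k)).mul (hF.res_mDown i)).mul (hF.res_connL i j k)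
lemma res_coefH : RestrictsTo (coefH F) hF.ring.cH :=
  RestrictsTo.sum fun i => RestrictsTo.sum fun j => RestrictsTo.sum fun k =>
    (((hF.res_mUp j).mul (hF.res_mUp k)).mul (hF.res_mDown i)).mul (hF.res_connL i j k)
lemma res_Phi : RestrictsTo (Phi F) hF.ring.Ph := by
  rw [← FinslerRing.Ph_eq]
  exact (RestrictsTo.sum fun k => (hF.res_eta k).star.mul (hF.res_deltaBar hF.res_coefA k)).add
    ((hF.res_coefA.mul hF.res_F).mul (hF.res_coefJ.star.add hF.res_coefY.star))
lemma res_Omega : RestrictsTo (Omega F) hF.ring.Om := by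
  rw [← FinslerRing.Om_eq]
  exact (RestrictsTo.sum fun k => (hF.res_deltaBar hF.res_coefA k).mul (hF.res_mUp k).star).add
    (hF.res_coefA.mul (hF.res_coefV.star.add hF.res_coefH.star))

omit hF in
lemma eq_of_restrictsTo {f f' : C2 × C2 → ℂ} {r r' : smoothRing U} (h : RestrictsTo f r)
    (h' : RestrictsTo f' r') (e : ∀ p ∈ U, f p = f' p) : r = r' :=
  Subtype.ext (funext fun p => by rw [← h p, ← h' p, e p p.2])

omit hF in
lemma restrictsTo_zero : RestrictsTo (fun _ => 0) (0 : smoothRing U) := fun _ => rfl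

omit hF in
/-- A smooth function that is nonzero on a dense set is regular in the ring of smooth
functions. -/
lemma regular_of_dense {a : C2 × C2 → ℂ} {r : smoothRing U} (h : RestrictsTo a r)
    (hd : (U : Set (C2 × C2)) ⊆ closure {p | p ∈ U ∧ a p ≠ 0}) (x : smoothRing U)
    (hx : r * x = 0) : x = 0 := by
  refine eq_of_restrictsTo (restrictsTo_extZero x) restrictsTo_zero fun p hp => ?_
  by_contra hne
  have hc : ContinuousAt (extZero U x.1) p :=
    (ContDiffOn.continuousOn x.2).continuousAt (U.isOpen.mem_nhds hp)
  obtain ⟨q, ⟨hq, haq⟩, hxq⟩ :=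
    ((mem_closure_iff_frequently.1 (hd hp)).and_eventually (hc.eventually_ne hne)).exists
  have := congrFun (congrArg Subtype.val hx) ⟨q, hq⟩
  change r.1 ⟨q, hq⟩ * x.1 ⟨q, hq⟩ = 0 at this
  rw [← h ⟨q, hq⟩, ← extZero_of_mem x.1 hq] at this
  exact (mul_ne_zero haq hxq) this

lemma isSpecial
    (wk : ∀ p ∈ U, ∀ k : Fin 2, ∑ i, ∑ l, ∑ j, g F i l p * torsion F i j k p
      * p.2 j * star (p.2 l) = 0)
    (ws : ∀ p ∈ U, ∀ k : Fin 2, ∑ r, ∑ h, ∑ s, curvLow F r k h s p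
        * star (p.2 r) * star (p.2 h) * p.2 s
      = ∑ r, ∑ j, ∑ h, curvLow F r j h k p * star (p.2 r) * p.2 j * star (p.2 h))
    (reg : (U : Set (C2 × C2)) ⊆ closure {p | p ∈ U ∧ coefA F p ≠ 0})
    (phi : ∀ p ∈ U, ∀ k : Fin 2, delta F k (Phi F) p
      = Phi F p * ((coefJ F p + coefY F p) * lDown F k p
        + (coefV F p + coefH F p) * mDown F k p)) : hF.ring.IsSpecial where
  wk k := eq_of_restrictsTo
    (RestrictsTo.sum fun i => RestrictsTo.sum fun l => RestrictsTo.sum fun j =>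
      (((hF.res_g i l).mul ((hF.res_connL i j k).sub (hF.res_connL i k j))).mul
        (hF.res_eta j)).mul (hF.res_eta l).star) restrictsTo_zero fun p hp => wk p hp k
  ws k := eq_of_restrictsTo
    (RestrictsTo.sum fun r => RestrictsTo.sum fun h => RestrictsTo.sum fun s =>
      (((hF.res_curvLow r k h s).mul (hF.res_eta r).star).mul
        (hF.res_eta h).star).mul (hF.res_eta s))
    (RestrictsTo.sum fun r => RestrictsTo.sum fun j => RestrictsTo.sum fun h =>
      (((hF.res_curvLow r j h k).mul (hF.res_eta r).star).mul
        (hF.res_eta j)).mul (hF.res_eta h).star) fun p hp => ws p hp k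
  reg := regular_of_dense hF.res_coefA reg
  phi k := by
    rw [← FinslerRing.tr_eq]
    exact eq_of_restrictsTo (hF.res_delta hF.res_Phi k)
      (hF.res_Phi.mul (((hF.res_coefJ.add hF.res_coefY).mul (hF.res_lDown k)).add
        ((hF.res_coefV.add hF.res_coefH).mul (hF.res_mDown k)))) fun p hp => phi p hp k

lemma secLambda_eq_zero (H : hF.ring.IsSpecial) {p : C2 × C2} (hp : p ∈ U) :
    secLambda F p = 0 := by
  have h : RestrictsTo (fun p => ∑ r, ∑ j, ∑ h, ∑ k, curvLow F r j h k p * star (lUp F r p)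
      * lUp F j p * star (lUp F h p) * lUp F k p) _ :=
    RestrictsTo.sum fun r => RestrictsTo.sum fun j => RestrictsTo.sum fun h =>
      RestrictsTo.sum fun k => ((((hF.res_curvLow r j h k).mul (hF.res_lUp r).star).mul
        (hF.res_lUp j)).mul (hF.res_lUp h).star).mul (hF.res_lUp k)
  have e := congrFun (congrArg Subtype.val H.secLambda_eq_zero) ⟨p, hp⟩
  exact (congrArg (2 * ·) (h ⟨p, hp⟩)).trans e

lemma secMu_eq (H : hF.ring.IsSpecial) {p : C2 × C2} (hp : p ∈ U) :
    secMu F p = ((-2 * F p ^ 2 * ‖Omega F p‖ ^ 2 : ℝ) : ℂ) := by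
  have h : RestrictsTo (fun p => ∑ r, ∑ j, ∑ h, ∑ k, curvLow F r j h k p * star (mUp F r p)
      * mUp F j p * star (mUp F h p) * mUp F k p) _ :=
    RestrictsTo.sum fun r => RestrictsTo.sum fun j => RestrictsTo.sum fun h =>
      RestrictsTo.sum fun k => ((((hF.res_curvLow r j h k).mul (hF.res_mUp r).star).mul
        (hF.res_mUp j)).mul (hF.res_mUp h).star).mul (hF.res_mUp k)
  have e := congrFun (congrArg Subtype.val H.secMu_eq) ⟨p, hp⟩
  refine (congrArg (2 * ·) (h ⟨p, hp⟩)).trans (e.trans ?_)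
  change -2 * sq F p * (hF.ring.Om.1 ⟨p, hp⟩ * star (hF.ring.Om.1 ⟨p, hp⟩)) = _
  rw [← hF.res_Omega ⟨p, hp⟩, Complex.star_def, Complex.mul_conj, Complex.normSq_eq_norm_sq, LocalFinsler.sq]
  push_cast; ring

/-- If the curvature `K_μ` is constant, then `Ω` vanishes. -/
lemma Omega_eq_zero (H : hF.ring.IsSpecial) {k : ℝ} (hk : ∀ p ∈ U, secMu F p = k)
    {p : C2 × C2} (hp : p ∈ U) : Omega F p = 0 := by
  have hr : ∀ q ∈ U, -2 * F q ^ 2 * ‖Omega F q‖ ^ 2 = k := fun q hq =>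
    Complex.ofReal_injective ((hF.secMu_eq H hq).symm.trans (hk q hq))
  by_cases h0 : k = 0
  -- The zero constant is not invertible, but then the curvature formula itself gives `Ω = 0`.
  · have := hr p hp
    rw [h0] at this
    have hFp := (hF.pos p hp).ne'
    simpa [hFp] using this
  · let c (z : ℂ) : smoothRing U := toSmooth (fun _ => z) contDiffOn_const
    -- The constant value of `L|Ω|²` is `-k/2`, because `K_μ = -2 L|Ω|²`.
    have hc : ∀ j, hF.ring.delta j (c (-(k : ℂ) / 2)) = 0 := fun j =>
      eq_of_restrictsTo (hF.res_delta (restrictsTo_toSmooth _ _) j) restrictsTo_zero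
        fun q _ => by simp [delta, dZ, dEta, wirt]
    have hcd : c (-(k : ℂ) / 2) * c (-2 / k) = 1 := Subtype.ext (funext fun q => by
      have : (k : ℂ) ≠ 0 := Complex.ofReal_ne_zero.2 h0
      change -(k : ℂ) / 2 * (-2 / k) = 1
      field_simp)
    have hL : hF.ring.L * hF.ring.Om * hF.ring.Omb = c (-(k : ℂ) / 2) :=
      Subtype.ext (funext fun q => by
        change sq F q * hF.ring.Om.1 q * star (hF.ring.Om.1 q) = -(k : ℂ) / 2
        rw [← hF.res_Omega q, mul_assoc, Complex.star_def, Complex.mul_conj,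
          Complex.normSq_eq_norm_sq, LocalFinsler.sq, ← hr q q.2]
        push_cast; ring)
    rw [hF.res_Omega ⟨p, hp⟩, H.Om_eq_zero _ _ hc hcd hL]
    rfl

end IsLocalMetric

/-! ### Charts of the tangent bundle -/

section Charts

variable {M : Type*} [TopologicalSpace M] [ChartedSpace C2 M] [IsManifold 𝓘(ℂ, C2) ω M]

/-- On the open target this is the tangent map of the inverse chart, which is continuous because
that chart is holomorphic. -/
lemma continuousOn_tangentOfCoords {e : OpenPartialHomeomorph M C2} (he : e ∈ holCharts M) :
    ContinuousOn (tangentOfCoords e) {p | p.1 ∈ e.target} := by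
  have h := (contMDiffOn_symm_of_mem_maximalAtlas he).continuousOn_tangentMapWithin
    (WithTop.coe_le_coe.2 le_top |>.trans le_top) e.open_target.uniqueMDiffOn
  refine (h.comp (tangentBundleModelSpaceHomeomorph 𝓘(ℂ, C2)).symm.continuous.continuousOn
    fun p hp => hp).congr fun p (hp : p.1 ∈ e.target) => ?_
  have hd : mfderivWithin 𝓘(ℂ, C2) 𝓘(ℂ, C2) e.symm e.target p.1
      = mfderiv 𝓘(ℂ, C2) 𝓘(ℂ, C2) e.symm p.1 := mfderivWithin_of_isOpen e.open_target hp
  exact congrArg (fun A : C2 →L[ℂ] C2 => (⟨e.symm p.1, A p.2⟩ : TangentBundle 𝓘(ℂ, C2) M))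
    hd.symm

lemma isOpen_coordDomain {D : Set (TangentBundle 𝓘(ℂ, C2) M)} (hD : IsOpen D)
    {e : OpenPartialHomeomorph M C2} (he : e ∈ holCharts M) : IsOpen (coordDomain D e) :=
  (continuousOn_tangentOfCoords he).isOpen_inter_preimage
    (e.open_target.preimage continuous_fst) hD

omit [IsManifold 𝓘(ℂ, C2) ω M] in
lemma tangentOfCoords_smul (e : OpenPartialHomeomorph M C2) (p : C2 × C2) (c : ℂ) :
    tangentOfCoords e (p.1, c • p.2)
      = ⟨(tangentOfCoords e p).1, c • (tangentOfCoords e p).2⟩ := by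
  exact congrArg (Bundle.TotalSpace.mk (F := C2) (e.symm p.1))
    (map_smul (mfderiv 𝓘(ℂ, C2) 𝓘(ℂ, C2) e.symm p.1) c p.2)

namespace ComplexFinslerSurface

variable (S : ComplexFinslerSurface M)

lemma isLocalMetric {e : OpenPartialHomeomorph M C2} (he : e ∈ holCharts M) :
    IsLocalMetric (⟨S.locDom e, isOpen_coordDomain S.isOpen_dom he⟩ : Opens (C2 × C2))
      (S.loc e) where
  pos p hp := S.pos _ hp.2
  smooth := S.smooth e he
  smul_mem p hp c hc := by
    refine ⟨hp.1, ?_⟩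
    rw [tangentOfCoords_smul]
    exact S.smul_mem _ _ c hc hp.2
  homogeneous p hp c hc := by
    rw [loc, tangentOfCoords_smul]
    exact S.homogeneous _ _ c hc hp.2
  posDef p hp := S.posDef e he p hp

end ComplexFinslerSurface

end Charts

end

/-! ### The theorem, chart by chart. -/

theorem theorem4p11 {M : Type*} [TopologicalSpace M] [ChartedSpace C2 M]
    [IsManifold 𝓘(ℂ, C2) ω M] [ConnectedSpace M] (S : ComplexFinslerSurface M)
    (hK : S.IsWeaklyKahler) (hsym : S.IsWeaklySymmetric) (hA : S.ANonvanishing)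
    (hPhi : S.PhiCondition) :
    (∀ e ∈ holCharts M, ∀ p ∈ S.locDom e,
      LocalFinsler.secLambda (S.loc e) p = 0 ∧
      LocalFinsler.secMu (S.loc e) p
        = ((-2 * S.loc e p ^ 2 * ‖LocalFinsler.Omega (S.loc e) p‖ ^ 2 : ℝ) : ℂ) ∧
      -2 * S.loc e p ^ 2 * ‖LocalFinsler.Omega (S.loc e) p‖ ^ 2 ≤ 0) ∧
    ((∃ k : ℝ, ∀ e ∈ holCharts M, ∀ p ∈ S.locDom e,
        LocalFinsler.secMu (S.loc e) p = (k : ℂ)) ↔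
      (∃ c : ℂ, ∀ e ∈ holCharts M, ∀ p ∈ S.locDom e,
        LocalFinsler.Omega (S.loc e) p = c / (S.loc e p : ℂ))) := by
  have H : ∀ e (he : e ∈ holCharts M), (S.isLocalMetric he).ring.IsSpecial := fun e he =>
    (S.isLocalMetric he).isSpecial (hK e he) (hsym e he) (hA e he) (hPhi e he)
  refine ⟨fun e he p hp => ⟨(S.isLocalMetric he).secLambda_eq_zero (H e he) hp,
    (S.isLocalMetric he).secMu_eq (H e he) hp, ?_⟩, ?_, ?_⟩
  · have := mul_nonneg (sq_nonneg (S.loc e p)) (sq_nonneg ‖LocalFinsler.Omega (S.loc e) p‖)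
    linarith
  · rintro ⟨k, hk⟩
    -- Constant `K_μ` already forces `Ω = 0`, so `c = 0` serves in every chart.
    refine ⟨0, fun e he p hp => ?_⟩
    rw [(S.isLocalMetric he).Omega_eq_zero (H e he) (hk e he) hp, zero_div]
  · rintro ⟨c, hc⟩
    refine ⟨-2 * ‖c‖ ^ 2, fun e he p hp => ?_⟩
    have hpos : 0 < S.loc e p := (S.isLocalMetric he).pos p hp
    rw [(S.isLocalMetric he).secMu_eq (H e he) hp, hc e he p hp, norm_div, Complex.norm_real,
      Real.norm_of_nonneg hpos.le, div_pow]
    congr 1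
    field_simp
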